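/- For $t\in\mathbb{R}$ and $f\in L^2(\mathbb{R}^d)$ let $e^{it\Delta}f$ denote the solution at time $t$ of the Schrödinger equation $\partial_t u=i\Delta u$ with initial data $u(\cdot,0)=f$; that is, $e^{it\Delta}f\in L^2(\mathbb{R}^d)$ is the function with $\widehat{e^{it\Delta}f}(\xi)=e^{-4\pi^2 it\|\xi\|^2}\widehat f(\xi)$, where $\widehat f(\xi)=\int_{\mathbb{R}^d} f(x)e^{-2\pi i x\cdot\xi}\,dx$, extended to $L^2(\mathbb{R}^d)$ as usual. Let $$(p,q,d)\in\{(6,6,1),\,(4,8,1),\,(4,4,2)\},\qquad C(p,d)=\left(p^{-\frac1{2p}}\,2^{\frac1p-\frac14}\right)^d .$$ Then Gaussians maximize the Strichartz inequality for these exponents, with sharp constant $C(p,d)$. That is, for all $f\in L^2(\mathbb{R}^d)$, $$\Big\|\,\|e^{it\Delta}f(x)\|_{L^p(\mathbb{R}^d,dx)}\Big\|_{L^q(\mathbb{R},dt)}\le C(p,d)\,\|f\|_{L^2(\mathbb{R}^d)},$$ the constant $C(p,d)$ cannot be replaced by a smaller one, and equality holds for every Gaussian $f(x)=Ae^{-B\|x\|^2+u\cdot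 x}$ with $A,B\in\mathbb{C}$, $\operatorname{Re}B>0$ and $u\in\mathbb{C}^d$ (all of which belong to $L^2(\mathbb{R}^d)$). -/

import Mathlib

open MeasureTheory
open scoped ENNReal NNReal FourierTransform

noncomputable section

/-- The complex Hilbert space `L²(ℝᵈ, dx)`. -/
abbrev L2Space (d : ℕ) : Type :=
  Lp ℂ 2 (volume : Measure (EuclideanSpace ℝ (Fin d)))

/-- The symbol `e^{it(-4π²‖ξ‖²)}` of `e^{itΔ}`, for the Fourier transform
`f̂(ξ) = ∫ f(x) e^{-2πi x·ξ} dx`, under which `Δ` is multiplication by `-4π²‖ξ‖²`. -/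
def schrodingerSymbol {d : ℕ} (t : ℝ) (ξ : EuclideanSpace ℝ (Fin d)) : ℂ :=
  Complex.exp (Complex.I * ((t * (-(4 * Real.pi ^ 2 * ‖ξ‖ ^ 2)) : ℝ) : ℂ))

theorem norm_schrodingerSymbol {d : ℕ} (t : ℝ) (ξ : EuclideanSpace ℝ (Fin d)) :
    ‖schrodingerSymbol t ξ‖ = 1 := by
  rw [schrodingerSymbol, mul_comm, Complex.norm_exp_ofReal_mul_I]

theorem continuous_schrodingerSymbol {d : ℕ} (t : ℝ) :
    Continuous (schrodingerSymbol (d := d) t) := by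
  unfold schrodingerSymbol
  fun_prop

theorem memLp_schrodingerSymbol_mul {d : ℕ} (t : ℝ) (h : L2Space d) :
    MemLp (fun ξ => schrodingerSymbol t ξ * h ξ) 2 volume := by
  refine (Lp.memLp h).of_le
    ((continuous_schrodingerSymbol t).aestronglyMeasurable.mul (Lp.aestronglyMeasurable h)) ?_
  filter_upwards with ξ
  rw [norm_mul, norm_schrodingerSymbol, one_mul]

/-- The Schrödinger propagator `e^{itΔ}` on `L²(ℝᵈ)`: `e^{itΔ} f` is the function in `L²` whose
Fourier transform is `e^{-4π²it‖ξ‖²} f̂(ξ)`, that is, the value at time `t` of the solution `u` of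
`∂ₜ u = iΔu` with `u(·, 0) = f`. Here `𝓕` is the Fourier transform on `L²`. -/
def schrodingerPropagator {d : ℕ} (t : ℝ) (f : L2Space d) : L2Space d :=
  𝓕⁻ ((memLp_schrodingerSymbol_mul t (𝓕 f)).toLp)

/-- The mixed norm `‖ ‖e^{itΔ} f(x)‖_{L^p(dx)} ‖_{L^q(dt)}`, as an element of `[0, ∞]`. -/
def strichartzNorm {d : ℕ} (p q : ℝ≥0) (f : L2Space d) : ℝ≥0∞ :=
  eLpNorm (fun t : ℝ => eLpNorm (schrodingerPropagator t f) (p : ℝ≥0∞) volume) (q : ℝ≥0∞) volume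

/-- The Strichartz inequality in dimension `d`, with exponents `p, q` and constant `C`. -/
def StrichartzInequality (p q : ℝ≥0) (d : ℕ) (C : ℝ) : Prop :=
  ∀ f : L2Space d, strichartzNorm p q f ≤ ENNReal.ofReal C * eLpNorm f 2 volume

/-- The constant `C(p,d) = (p^{-1/(2p)} 2^{1/p - 1/4})^d`. -/
def sharpConst (p : ℝ≥0) (d : ℕ) : ℝ :=
  ((p : ℝ) ^ (-(1 / (2 * (p : ℝ)))) * (2 : ℝ) ^ (1 / (p : ℝ) - 1 / 4)) ^ d

/-- The Gaussian `x ↦ A exp(-B‖x‖² + u·x)`, where `u·x = ∑ⱼ uⱼ xⱼ` (no conjugation). -/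
def gaussianFun {d : ℕ} (A B : ℂ) (u : Fin d → ℂ) (x : EuclideanSpace ℝ (Fin d)) : ℂ :=
  A * Complex.exp (-B * ((‖x‖ ^ 2 : ℝ) : ℂ) + ∑ j, u j * ((x j : ℝ) : ℂ))

end

/-! Since the exponent in `x` is even, powers of the solution linearize. With `g` the Fourier
transform of the data, the square or cube of `extension g t x` is an oscillatory integral of `g ⊗ g`
or `g ⊗ g ⊗ g`, whose phase sees the frequencies only through their sum `η` and the sum of their
squared norms. For two frequencies in the plane, or three on the line, what remains once `η` is
fixed is a plane, with coordinate `z : ℂ`, and the sum of squares is `a‖η‖² + b‖z‖²`. Plancherel in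
`x` isolates `η`; in the variable `‖z‖²`, Plancherel in `t` leaves the integral of the data over
each circle; Cauchy–Schwarz on the circle is the only real loss. This is `lintegral_extension_le`,
and it gives `(4,4,2)` and `(6,6,1)`. The case `(4,8,1)` follows by applying `(4,4,2)` to tensor
products. Density and Fatou pass to all of `L²`.

Equality for Gaussians is computed directly: the flow sends the parameter `B` to `(B⁻¹ + 4it)⁻¹`,
the `L^p`/`L²` ratio is a constant times the power `1/q` of its real part, and the time integral of
that real part is `π/4` for every `B`. The resulting constant is `sharpConst`, so a single Gaussian
also shows that it is optimal. -/

noncomputable section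

/-! ### Unimodular phases and Plancherel for integrals. -/

/-- The unimodular number `e^{iθ}`. -/
def phase (θ : ℝ) : ℂ := Complex.exp (Complex.I * (θ : ℂ))

theorem norm_phase (θ : ℝ) : ‖phase θ‖ = 1 := by
  rw [phase, mul_comm, Complex.norm_exp_ofReal_mul_I]

theorem enorm_phase (θ : ℝ) : ‖phase θ‖ₑ = 1 := by
  rw [← ofReal_norm, norm_phase, ENNReal.ofReal_one]

@[fun_prop]
theorem continuous_phase : Continuous phase := by
  unfold phase
  fun_prop

@[fun_prop]
theorem measurable_phase : Measurable phase := continuous_phase.measurable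

theorem phase_add (a b : ℝ) : phase (a + b) = phase a * phase b := by
  simp only [phase, ← Complex.exp_add]
  push_cast
  ring_nf

section General

variable {X : Type*} [MeasurableSpace X] {μ : Measure X}

theorem integrable_phase_mul {θ : X → ℝ} (hθ : Measurable θ) {h : X → ℂ} (hh : Integrable h μ) :
    Integrable (fun x => phase (θ x) * h x) μ := by
  refine hh.mono ((measurable_phase.comp hθ).aestronglyMeasurable.mul hh.aestronglyMeasurable) ?_
  filter_upwards with x
  simp [norm_phase]

theorem continuous_integral_phase_mul {Y : Type*} [TopologicalSpace Y] [FirstCountableTopology Y]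
    {θ : Y → X → ℝ} (hθ : ∀ x, Continuous fun y => θ y x) (hm : ∀ y, Measurable (θ y))
    {h : X → ℂ} (hh : Integrable h μ) :
    Continuous fun y => ∫ x, phase (θ y x) * h x ∂μ := by
  refine continuous_of_dominated (fun y => (integrable_phase_mul (hm y) hh).aestronglyMeasurable)
    (bound := fun x => ‖h x‖) (fun y => ?_) hh.norm ?_
  · filter_upwards with x
    simp [norm_phase]
  · filter_upwards with x
    exact (continuous_phase.comp (hθ x)).mul continuous_const

end General

section Fourier

variable {E : Type*} [NormedAddCommGroup E] [InnerProductSpace ℝ E] [FiniteDimensional ℝ E]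
  [MeasurableSpace E] [BorelSpace E]

theorem fourierInv_eq_integral_phase (h : E → ℂ) (x : E) :
    𝓕⁻ h x = ∫ ξ, phase (2 * Real.pi * inner ℝ ξ x) * h ξ := by
  rw [Real.fourierInv_eq']
  simp [phase, mul_comm]

/-- The inverse Fourier transform on `L²` is given by the integral on `L¹ ∩ L²`. -/
theorem fourierInv_toLp_ae_eq {h : E → ℂ} (hh : Integrable h) (hh2 : MemLp h 2 volume) :
    (𝓕⁻ (hh2.toLp h) : Lp ℂ 2 (volume : Measure E)) =ᵐ[volume] 𝓕⁻ h := by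
  refine ae_eq_of_integral_contDiff_smul_eq ((Lp.memLp _).locallyIntegrable (by norm_num))
    (Continuous.locallyIntegrable ?_) fun g g_smooth g_cpt => ?_
  · simp_rw [funext (fourierInv_eq_integral_phase h)]
    exact continuous_integral_phase_mul (fun _ => by fun_prop) (fun _ => by fun_prop) hh
  · have hg₁ : HasCompactSupport (Complex.ofRealCLM ∘ g) := g_cpt.comp_left rfl
    have hg₂ : ContDiff ℝ ((⊤ : ℕ∞) : WithTop ℕ∞) (Complex.ofRealCLM ∘ g) := by fun_prop
    set φ := hg₁.toSchwartzMap hg₂ with hφ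
    have hφg : ∀ x, φ x = (g x : ℂ) := fun x => by simp [hφ]
    -- Against a test function, both sides become the pairing of `h` with `𝓕⁻ φ`: by distributional
    -- duality for the `L²` transform, by Fubini for the integral.
    have h1 : ∫ x, φ x • (𝓕⁻ (hh2.toLp h) : Lp ℂ 2 (volume : Measure E)) x
        = ∫ x, (𝓕⁻ φ) x • (hh2.toLp h) x := by
      rw [← Lp.toTemperedDistribution_apply, ← Lp.toTemperedDistribution_apply,
        ← Lp.fourierInv_toTemperedDistribution_eq, TemperedDistribution.fourierInv_apply]
    have h2 : ∫ x, (𝓕⁻ φ) x • (hh2.toLp h) x = ∫ x, (𝓕⁻ φ) x • h x := by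
      refine integral_congr_ae ?_
      filter_upwards [hh2.coeFn_toLp] with x hx
      rw [hx]
    have h3 : ∫ x, (𝓕⁻ φ) x • h x = ∫ x, φ x • 𝓕⁻ h x := by
      have := VectorFourier.integral_fourierIntegral_smul_eq_flip (μ := (volume : Measure E))
        (ν := (volume : Measure E)) (L := -innerₗ E) (f := φ) (g := h) Real.continuous_fourierChar
        (by simpa using! continuous_inner.neg) φ.integrable hh
      rw [SchwartzMap.fourierInv_coe]
      have hflip : (-innerₗ E).flip = -innerₗ E := by
        ext x y
        simp [real_inner_comm]
      rw [hflip] at this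
      exact this
    have h4 := h1.trans (h2.trans h3)
    simpa [hφg] using! h4

/-- Plancherel, stated as an inequality in `[0, ∞]` so that integrability suffices: if `h` is not
square integrable, the right side is infinite. -/
theorem lintegral_fourierInv_le {h : E → ℂ} (hh : Integrable h) :
    ∫⁻ x, ‖∫ ξ, phase (2 * Real.pi * inner ℝ ξ x) * h ξ‖ₑ ^ 2 ≤ ∫⁻ ξ, ‖h ξ‖ₑ ^ 2 := by
  by_cases htop : ∫⁻ ξ, ‖h ξ‖ₑ ^ 2 = ∞
  · rw [htop]
    exact le_top
  have hsq : ∀ f : E → ℂ, (eLpNorm f 2 volume) ^ 2 = ∫⁻ ξ, ‖f ξ‖ₑ ^ 2 := fun f => by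
    have := eLpNorm_nnreal_pow_eq_lintegral (μ := volume) (f := f) (p := 2) (by norm_num)
    simpa using! this
  have hh2 : MemLp h 2 volume := by
    refine ⟨hh.aestronglyMeasurable, ?_⟩
    rw [← hsq] at htop
    exact lt_top_iff_ne_top.2 fun h => htop (by simp [h])
  simp_rw [← fourierInv_eq_integral_phase]
  rw [← hsq, ← hsq, ← eLpNorm_congr_ae (fourierInv_toLp_ae_eq hh hh2), ← Lp.enorm_def]
  have : ‖(𝓕⁻ (hh2.toLp h) : Lp ℂ 2 (volume : Measure E))‖ₑ = ‖hh2.toLp h‖ₑ := by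
    rw [← ofReal_norm, ← ofReal_norm, ← Lp.norm_fourier_eq, FourierTransform.fourier_fourierInv_eq]
  rw [this, Lp.enorm_toLp]

end Fourier
end

/-! ### Oscillation in the squared modulus on the plane. -/

noncomputable section

theorem enorm_integral_sq_le {X : Type*} [MeasurableSpace X] (μ : Measure X) {f : X → ℂ}
    (hf : AEStronglyMeasurable f μ) :
    ‖∫ x, f x ∂μ‖ₑ ^ 2 ≤ μ Set.univ * ∫⁻ x, ‖f x‖ₑ ^ 2 ∂μ := by
  have h1 : ‖∫ x, f x ∂μ‖ₑ ≤ ∫⁻ x, ‖f x‖ₑ ∂μ := enorm_integral_le_lintegral_enorm _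
  have h2 := ENNReal.lintegral_mul_le_Lp_mul_Lq μ Real.HolderConjugate.two_two
    (f := fun _ => 1) (g := fun x => ‖f x‖ₑ) aemeasurable_const hf.enorm
  simp only [Pi.mul_apply, one_mul, lintegral_const, ENNReal.rpow_two] at h2
  have h3 : ∀ a : ℝ≥0∞, (a ^ (1 / 2 : ℝ)) ^ 2 = a := fun a => by
    rw [← ENNReal.rpow_natCast, ← ENNReal.rpow_mul]
    norm_num
  calc _ ≤ (∫⁻ x, ‖f x‖ₑ ∂μ) ^ 2 := by gcongr
    _ ≤ ((1 ^ 2 * μ Set.univ) ^ (1 / 2 : ℝ) * (∫⁻ x, ‖f x‖ₑ ^ 2 ∂μ) ^ (1 / 2 : ℝ)) ^ 2 := by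
        gcongr
    _ = _ := by rw [mul_pow, h3, h3, one_pow, one_mul]

/-- The point of `ℂ` with squared modulus `s` and argument `θ`. -/
def areaPolar (p : ℝ × ℝ) : ℂ := Complex.polarCoord.symm (√p.1, p.2)

@[fun_prop]
theorem measurable_areaPolar : Measurable areaPolar := by
  unfold areaPolar
  simp only [Complex.polarCoord_symm_apply]
  fun_prop

theorem norm_areaPolar_sq {p : ℝ × ℝ} (hp : 0 < p.1) : ‖areaPolar p‖ ^ 2 = p.1 := by
  rw [areaPolar, Complex.norm_polarCoord_symm, sq_abs, Real.sq_sqrt hp.le]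

/-- The domain of the coordinates `areaPolar`, with Lebesgue measure. -/
abbrev areaPolarMeasure : Measure (ℝ × ℝ) :=
  (volume.restrict (Set.Ioi 0)).prod (volume.restrict (Set.Ioo (-Real.pi) Real.pi))

theorem lintegral_Ioi_comp_sq (f : ℝ → ℝ≥0∞) :
    ∫⁻ s in Set.Ioi 0, f s = ∫⁻ r in Set.Ioi 0, ENNReal.ofReal (2 * r) * f (r ^ 2) := by
  have himg : (fun r : ℝ => r ^ 2) '' Set.Ioi 0 = Set.Ioi 0 := by
    ext s
    constructor
    · rintro ⟨r, hr, rfl⟩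
      exact pow_pos (Set.mem_Ioi.1 hr) 2
    · intro hs
      exact ⟨√s, Real.sqrt_pos.2 hs, Real.sq_sqrt (le_of_lt hs)⟩
  have := lintegral_image_eq_lintegral_abs_deriv_mul (s := Set.Ioi (0 : ℝ)) measurableSet_Ioi
    (f := fun r => r ^ 2) (f' := fun r => 2 * r)
    (fun x _ => by simpa using (hasDerivAt_pow 2 x).hasDerivWithinAt)
    (fun x hx y hy h => (sq_eq_sq₀ (le_of_lt hx) (le_of_lt hy)).1 h) f
  rw [himg] at this
  rw [this]
  refine setLIntegral_congr_fun measurableSet_Ioi fun r hr => ?_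
  rw [abs_of_pos (by have := Set.mem_Ioi.1 hr; positivity)]

/-- With `s = r²`, the area element `r dr dθ` is `½ ds dθ`. -/
theorem map_areaPolar : areaPolarMeasure.map areaPolar = (2 : ℝ≥0∞) • volume := by
  refine Measure.ext_of_lintegral _ fun f hf => ?_
  rw [lintegral_map hf measurable_areaPolar, lintegral_smul_measure,
    lintegral_prod _ (by fun_prop), lintegral_Ioi_comp_sq, ← Complex.lintegral_comp_polarCoord_symm,
    polarCoord_target, Measure.volume_eq_prod, ← Measure.prod_restrict, lintegral_prod, smul_eq_mul,
    ← lintegral_const_mul]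
  · refine setLIntegral_congr_fun measurableSet_Ioi fun r hr => ?_
    have hr' : 0 < r := hr
    simp only [areaPolar, Real.sqrt_sq hr'.le, smul_eq_mul]
    rw [lintegral_const_mul, ← mul_assoc, ENNReal.ofReal_mul (by norm_num)]
    · simp
    · simp only [Complex.polarCoord_symm_apply]
      fun_prop
  · simp only [Complex.polarCoord_symm_apply]
    refine Measurable.lintegral_prod_right' (f := fun p : ℝ × ℝ => ENNReal.ofReal p.1 •
      f (p.1 * (Real.cos p.2 + Real.sin p.2 * Complex.I))) ?_
    fun_prop
  · simp only [Complex.polarCoord_symm_apply]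
    fun_prop

theorem lintegral_comp_mul_left_real {f : ℝ → ℝ≥0∞} (hf : Measurable f) {c : ℝ} (hc : c ≠ 0) :
    ∫⁻ t, f (c * t) = ENNReal.ofReal |c⁻¹| * ∫⁻ t, f t := by
  rw [← lintegral_map (f := f) (g := fun t => c * t) hf (by fun_prop), Real.map_volume_mul_left hc,
    lintegral_smul_measure, smul_eq_mul]

/-- The phase depends on `z` only through `s = ‖z‖²`, so the inner integral is a one-dimensional
inverse Fourier transform, evaluated at `-2πbt`, of an angular integral of `g`. Plancherel in `t`
contributes `1/(2πb)` and Cauchy–Schwarz on circles contributes `π`. -/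
theorem lintegral_radial_oscillation_le {g : ℂ → ℂ} (hg : Integrable g) {b : ℝ} (hb : 0 < b) :
    ∫⁻ t : ℝ, ‖∫ z, phase (-(4 * Real.pi ^ 2 * t * (b * ‖z‖ ^ 2))) * g z‖ₑ ^ 2 ≤
      ENNReal.ofReal (1 / (2 * b)) * ∫⁻ z, ‖g z‖ₑ ^ 2 := by
  set μ₁ : Measure ℝ := volume.restrict (Set.Ioi 0)
  set μ₂ : Measure ℝ := volume.restrict (Set.Ioo (-Real.pi) Real.pi)
  have hvol : (volume : Measure ℂ) = (2⁻¹ : ℝ≥0∞) • areaPolarMeasure.map areaPolar := by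
    rw [map_areaPolar, smul_smul, ENNReal.inv_mul_cancel (by norm_num) (by norm_num), one_smul]
  have hgm : Integrable g (areaPolarMeasure.map areaPolar) := by
    rw [map_areaPolar]
    exact hg.smul_measure (by norm_num)
  have hG : Integrable (g ∘ areaPolar) (μ₁.prod μ₂) :=
    hgm.comp_measurable measurable_areaPolar
  -- The factor `2⁻¹` is the Jacobian of `areaPolar`; extension by zero makes `φ` a function on the
  -- whole line.
  set φ : ℝ → ℂ := (Set.Ioi 0).indicator fun s => 2⁻¹ * ∫ θ, g (areaPolar (s, θ)) ∂μ₂ with hφ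
  have hφi : Integrable φ := by
    rw [hφ, integrable_indicator_iff measurableSet_Ioi]
    exact hG.integral_prod_left.const_mul _
  have key : ∀ t : ℝ, ∫ z, phase (-(4 * Real.pi ^ 2 * t * (b * ‖z‖ ^ 2))) * g z =
      ∫ s, phase (2 * Real.pi * inner ℝ s ((-(2 * Real.pi * b)) * t)) * φ s := by
    intro t
    have hm : Measurable fun z : ℂ => -(4 * Real.pi ^ 2 * t * (b * ‖z‖ ^ 2)) := by fun_prop
    have hi := (integrable_phase_mul hm hgm).comp_measurable measurable_areaPolar
    rw [hvol, integral_smul_measure, integral_map measurable_areaPolar.aemeasurable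
      (integrable_phase_mul hm hgm).aestronglyMeasurable, ← Function.comp_def
      (fun z => phase (-(4 * Real.pi ^ 2 * t * (b * ‖z‖ ^ 2))) * g z), integral_prod _ hi]
    have hsplit : ∀ s, phase (2 * Real.pi * inner ℝ s ((-(2 * Real.pi * b)) * t)) * φ s =
        (Set.Ioi 0).indicator (fun s => phase (2 * Real.pi * inner ℝ s ((-(2 * Real.pi * b)) * t)) *
          (2⁻¹ * ∫ θ, g (areaPolar (s, θ)) ∂μ₂)) s := fun s => by
      by_cases hs : s ∈ Set.Ioi (0 : ℝ) <;> simp [hφ, hs]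
    simp_rw [hsplit]
    rw [integral_indicator measurableSet_Ioi, ← integral_smul]
    refine setIntegral_congr_fun measurableSet_Ioi fun s hs => ?_
    have : ∀ θ, ‖areaPolar (s, θ)‖ ^ 2 = s := fun θ => norm_areaPolar_sq hs
    simp only [Function.comp_apply, this]
    rw [integral_const_mul]
    rw [Complex.real_smul, mul_left_comm]
    simp only [ENNReal.toReal_inv, ENNReal.toReal_ofNat, Complex.ofReal_inv, Complex.ofReal_ofNat,
      RCLike.inner_apply, conj_trivial]
    congr 3
    ring
  -- Here `π = ¼ · 2π · 2`: the square of `2⁻¹`, the length of the angular interval, and the factor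
  -- of `map_areaPolar`.
  have hφ2 : ∫⁻ s, ‖φ s‖ₑ ^ 2 ≤ ENNReal.ofReal Real.pi * ∫⁻ z, ‖g z‖ₑ ^ 2 := by
    have h1 : ∀ s, ‖φ s‖ₑ ^ 2 = (Set.Ioi 0).indicator
        (fun s => ‖(2⁻¹ : ℂ) * ∫ θ, g (areaPolar (s, θ)) ∂μ₂‖ₑ ^ 2) s := fun s => by
      by_cases hs : s ∈ Set.Ioi (0 : ℝ) <;> simp [hφ, hs]
    have hgsm : AEMeasurable (fun z => ‖g z‖ₑ ^ 2) (areaPolarMeasure.map areaPolar) :=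
      hgm.aestronglyMeasurable.enorm.pow_const 2
    have h2 : ∫⁻ z, ‖g z‖ₑ ^ 2 ∂(areaPolarMeasure.map areaPolar) =
        ∫⁻ s, ∫⁻ θ, ‖g (areaPolar (s, θ))‖ₑ ^ 2 ∂μ₂ ∂μ₁ := by
      rw [lintegral_map' hgsm measurable_areaPolar.aemeasurable, lintegral_prod]
      exact hG.aestronglyMeasurable.enorm.pow_const 2
    simp_rw [h1]
    rw [lintegral_indicator measurableSet_Ioi]
    calc _ ≤ ∫⁻ s, (4⁻¹ * ENNReal.ofReal (2 * Real.pi)) *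
          ∫⁻ θ, ‖g (areaPolar (s, θ))‖ₑ ^ 2 ∂μ₂ ∂μ₁ := by
          refine lintegral_mono_ae ?_
          filter_upwards [hG.aestronglyMeasurable.prodMk_left] with s hs
          have := enorm_integral_sq_le μ₂ hs
          simp only [Function.comp_apply] at this
          rw [enorm_mul, mul_pow, mul_assoc]
          have h4 : ‖(2⁻¹ : ℂ)‖ₑ ^ 2 = 4⁻¹ := by
            rw [enorm_inv (by norm_num), ← ofReal_norm]
            norm_num
            rw [← ENNReal.inv_pow]
            norm_num
          rw [h4]
          gcongr
          refine this.trans_eq ?_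
          congr 1
          simp [μ₂, two_mul]
      _ = (4⁻¹ * ENNReal.ofReal (2 * Real.pi)) *
          ∫⁻ z, ‖g z‖ₑ ^ 2 ∂(areaPolarMeasure.map areaPolar) := by
          rw [h2, lintegral_const_mul' _ _ (by finiteness)]
      _ = _ := by
          have h4 : (4⁻¹ * ENNReal.ofReal 2 * 2 : ℝ≥0∞) = 1 := by
            rw [ENNReal.ofReal_ofNat, mul_assoc, show (2 * 2 : ℝ≥0∞) = 4 by norm_num]
            exact ENNReal.inv_mul_cancel (by norm_num) (by norm_num)
          rw [map_areaPolar, lintegral_smul_measure, smul_eq_mul, ENNReal.ofReal_mul (by norm_num)]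
          calc _ = (4⁻¹ * ENNReal.ofReal 2 * 2) *
                (ENNReal.ofReal Real.pi * ∫⁻ z, ‖g z‖ₑ ^ 2) := by ring
            _ = _ := by rw [h4, one_mul]
  simp_rw [key]
  have hcont : Continuous fun x : ℝ => ∫ s, phase (2 * Real.pi * inner ℝ s x) * φ s :=
    continuous_integral_phase_mul (fun _ => by fun_prop) (fun _ => by fun_prop) hφi
  have hne : -(2 * Real.pi * b) ≠ 0 := neg_ne_zero.2 (by positivity)
  rw [lintegral_comp_mul_left_real
    (f := fun x => ‖∫ s, phase (2 * Real.pi * inner ℝ s x) * φ s‖ₑ ^ 2)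
    (hcont.measurable.enorm.pow_const 2) hne]
  calc _ ≤ ENNReal.ofReal |(-(2 * Real.pi * b))⁻¹| * ∫⁻ s, ‖φ s‖ₑ ^ 2 := by
        exact mul_le_mul_right (lintegral_fourierInv_le hφi) _
    _ ≤ ENNReal.ofReal |(-(2 * Real.pi * b))⁻¹| *
        (ENNReal.ofReal Real.pi * ∫⁻ z, ‖g z‖ₑ ^ 2) := by gcongr
    _ = _ := by
        rw [← mul_assoc, ← ENNReal.ofReal_mul (by positivity), abs_inv, abs_neg,
          abs_of_pos (by positivity)]
        congr 2
        field_simp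

end

/-! ### The space-time `L²` bound in sum and circle coordinates. -/

noncomputable section

section Core

variable {E : Type*} [NormedAddCommGroup E] [InnerProductSpace ℝ E] [FiniteDimensional ℝ E]
  [MeasurableSpace E] [BorelSpace E]

/-- At fixed `t`, Plancherel in `x` turns the integral into one over `η`. The term `a‖η‖²` then
contributes only a unimodular factor, and after Tonelli the radial estimate applies on almost every
slice. Strong measurability of `G` makes `k` jointly measurable in `(t, η)`, as Tonelli requires. -/
theorem lintegral_paraboloid_prod_le_of_stronglyMeasurable {G : E × ℂ → ℂ}
    (hGm : StronglyMeasurable G) (hG : Integrable G (volume.prod volume)) (a : ℝ) {b : ℝ}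
    (hb : 0 < b) :
    ∫⁻ t : ℝ, ∫⁻ x : E, ‖∫ p, phase (2 * Real.pi * inner ℝ p.1 x -
        4 * Real.pi ^ 2 * t * (a * ‖p.1‖ ^ 2 + b * ‖p.2‖ ^ 2)) * G p ∂(volume.prod volume)‖ₑ ^ 2 ≤
      ENNReal.ofReal (1 / (2 * b)) * ∫⁻ p, ‖G p‖ₑ ^ 2 ∂(volume.prod volume) := by
  set k : ℝ → E → ℂ := fun t η => ∫ z, phase (-(4 * Real.pi ^ 2 * t * (b * ‖z‖ ^ 2))) * G (η, z)
  set h : ℝ → E → ℂ := fun t η => phase (-(4 * Real.pi ^ 2 * t * (a * ‖η‖ ^ 2))) * k t η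
  have hk : Measurable fun p : ℝ × E => k p.1 p.2 := by
    refine StronglyMeasurable.measurable (StronglyMeasurable.integral_prod_right'
      (f := fun q : (ℝ × E) × ℂ => phase (-(4 * Real.pi ^ 2 * q.1.1 * (b * ‖q.2‖ ^ 2))) *
        G (q.1.2, q.2)) (Measurable.stronglyMeasurable ?_))
    have := hGm.measurable
    fun_prop
  have hphase : ∀ t, Integrable (fun p : E × ℂ =>
      phase (-(4 * Real.pi ^ 2 * t * (b * ‖p.2‖ ^ 2))) * G p) (volume.prod volume) := fun t =>
    integrable_phase_mul (by fun_prop) hG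
  have hki : ∀ t, Integrable (k t) := fun t => (hphase t).integral_prod_left
  have hhi : ∀ t, Integrable (h t) := fun t => integrable_phase_mul (by fun_prop) (hki t)
  have key : ∀ t x, ∫ p, phase (2 * Real.pi * inner ℝ p.1 x -
        4 * Real.pi ^ 2 * t * (a * ‖p.1‖ ^ 2 + b * ‖p.2‖ ^ 2)) * G p ∂(volume.prod volume) =
      ∫ η, phase (2 * Real.pi * inner ℝ η x) * h t η := by
    intro t x
    rw [integral_prod _ (integrable_phase_mul (by fun_prop) hG)]
    refine integral_congr_ae (Filter.Eventually.of_forall fun η => ?_)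
    simp only [h, k]
    rw [← integral_const_mul, ← integral_const_mul]
    refine integral_congr_ae (Filter.Eventually.of_forall fun z => ?_)
    simp only [← mul_assoc, ← phase_add]
    ring_nf
  simp_rw [key]
  calc _ ≤ ∫⁻ t : ℝ, ∫⁻ η, ‖h t η‖ₑ ^ 2 := lintegral_mono fun t => lintegral_fourierInv_le (hhi t)
    _ = ∫⁻ t : ℝ, ∫⁻ η, ‖k t η‖ₑ ^ 2 := by simp only [h, enorm_mul, enorm_phase, one_mul]
    _ = ∫⁻ η, ∫⁻ t : ℝ, ‖k t η‖ₑ ^ 2 :=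
        lintegral_lintegral_swap (hk.enorm.pow_const 2).aemeasurable
    _ ≤ ∫⁻ η, ENNReal.ofReal (1 / (2 * b)) * ∫⁻ z, ‖G (η, z)‖ₑ ^ 2 := by
        refine lintegral_mono_ae ?_
        filter_upwards [hG.prod_right_ae] with η hη
        exact lintegral_radial_oscillation_le hη hb
    _ = _ := by
        rw [lintegral_const_mul' _ _ ENNReal.ofReal_ne_top, lintegral_prod]
        exact hG.aestronglyMeasurable.enorm.pow_const 2

theorem lintegral_paraboloid_prod_le {G : E × ℂ → ℂ} (hG : Integrable G (volume.prod volume))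
    (a : ℝ) {b : ℝ} (hb : 0 < b) :
    ∫⁻ t : ℝ, ∫⁻ x : E, ‖∫ p, phase (2 * Real.pi * inner ℝ p.1 x -
        4 * Real.pi ^ 2 * t * (a * ‖p.1‖ ^ 2 + b * ‖p.2‖ ^ 2)) * G p ∂(volume.prod volume)‖ₑ ^ 2 ≤
      ENNReal.ofReal (1 / (2 * b)) * ∫⁻ p, ‖G p‖ₑ ^ 2 ∂(volume.prod volume) := by
  have hae := hG.aestronglyMeasurable.ae_eq_mk
  have := lintegral_paraboloid_prod_le_of_stronglyMeasurable
    hG.aestronglyMeasurable.stronglyMeasurable_mk (hG.congr hae) a hb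
  have h1 : ∀ f : E × ℂ → ℂ, ∫ p, f p * G p ∂(volume.prod volume) =
      ∫ p, f p * hG.aestronglyMeasurable.mk G p ∂(volume.prod volume) := fun f => by
    refine integral_congr_ae ?_
    filter_upwards [hae] with p hp
    rw [hp]
  have h2 : ∫⁻ p, ‖G p‖ₑ ^ 2 ∂(volume.prod volume) =
      ∫⁻ p, ‖hG.aestronglyMeasurable.mk G p‖ₑ ^ 2 ∂(volume.prod volume) := by
    refine lintegral_congr_ae ?_
    filter_upwards [hae] with p hp
    rw [hp]
  simp_rw [h1]
  rwa [h2]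

variable {X : Type*} [MeasurableSpace X]

/-- The space-time `L²` bound for the extension operator of a paraboloid-like map `ω ↦ (S ω, Q ω)`
whose fibres are parametrised by circles. -/
theorem lintegral_extension_le {μ : Measure X} {T : E × ℂ → X} (hTm : Measurable T) {c : ℝ}
    (hc : 0 < c) (hT : (volume.prod volume).map T = ENNReal.ofReal c • μ)
    {S : X → E} {Q : X → ℝ} (hS : Measurable S) (hQ : Measurable Q) {a b : ℝ} (hb : 0 < b)
    (hST : ∀ p, S (T p) = p.1) (hQT : ∀ p, Q (T p) = a * ‖p.1‖ ^ 2 + b * ‖p.2‖ ^ 2)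
    {F : X → ℂ} (hF : Integrable F μ) :
    ∫⁻ t : ℝ, ∫⁻ x : E, ‖∫ ω, phase (2 * Real.pi * inner ℝ (S ω) x -
        4 * Real.pi ^ 2 * t * Q ω) * F ω ∂μ‖ₑ ^ 2 ≤
      ENNReal.ofReal (1 / (2 * b * c)) * ∫⁻ ω, ‖F ω‖ₑ ^ 2 ∂μ := by
  have hc0 : ENNReal.ofReal c ≠ 0 := by simpa using hc
  have hFm : Integrable F ((volume.prod volume).map T) := by
    rw [hT]
    exact hF.smul_measure ENNReal.ofReal_ne_top
  have hG : Integrable (F ∘ T) (volume.prod volume) := hFm.comp_measurable hTm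
  have hμ : μ = (ENNReal.ofReal c)⁻¹ • (volume.prod volume).map T := by
    rw [hT, smul_smul, ENNReal.inv_mul_cancel hc0 ENNReal.ofReal_ne_top, one_smul]
  have key : ∀ t x, ∫ ω, phase (2 * Real.pi * inner ℝ (S ω) x -
      4 * Real.pi ^ 2 * t * Q ω) * F ω ∂μ = c⁻¹ • ∫ p, phase (2 * Real.pi * inner ℝ p.1 x -
        4 * Real.pi ^ 2 * t * (a * ‖p.1‖ ^ 2 + b * ‖p.2‖ ^ 2)) *
          (F ∘ T) p ∂(volume.prod volume) := by
    intro t x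
    rw [hμ, integral_smul_measure, integral_map hTm.aemeasurable
      (integrable_phase_mul (by fun_prop) hFm).aestronglyMeasurable, ENNReal.toReal_inv,
      ENNReal.toReal_ofReal hc.le]
    simp only [hST, hQT, Function.comp_apply]
  have hF2 : ∫⁻ p, ‖(F ∘ T) p‖ₑ ^ 2 ∂(volume.prod volume) =
      ENNReal.ofReal c * ∫⁻ ω, ‖F ω‖ₑ ^ 2 ∂μ := by
    rw [← smul_eq_mul, ← lintegral_smul_measure, ← hT, lintegral_map' _ hTm.aemeasurable]
    · rfl
    · exact hFm.aestronglyMeasurable.enorm.pow_const 2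
  have hc2 : ‖c⁻¹‖ₑ ^ 2 ≠ ∞ := by finiteness
  simp_rw [key, enorm_smul, mul_pow, lintegral_const_mul' _ _ hc2]
  -- The integral inside the square contributes `c⁻²` and the norm of the data on the right
  -- contributes `c`, leaving `c⁻¹`.
  calc _ ≤ ‖c⁻¹‖ₑ ^ 2 * (ENNReal.ofReal (1 / (2 * b)) *
        (ENNReal.ofReal c * ∫⁻ ω, ‖F ω‖ₑ ^ 2 ∂μ)) := by
        rw [← hF2]
        exact mul_le_mul_right (lintegral_paraboloid_prod_le hG a hb) _
    _ = _ := by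
        rw [← ofReal_norm, ← ENNReal.ofReal_pow (by positivity), ← mul_assoc, ← mul_assoc,
          ← ENNReal.ofReal_mul (by positivity), ← ENNReal.ofReal_mul (by positivity)]
        congr 2
        rw [Real.norm_of_nonneg (by positivity)]
        field_simp

end Core
end

/-! ### The extension operator and its bilinear and trilinear estimates. -/

noncomputable section

section Extension

variable {E : Type*} [NormedAddCommGroup E] [InnerProductSpace ℝ E] [FiniteDimensional ℝ E]
  [MeasurableSpace E] [BorelSpace E]

/-- The solution of the free Schrödinger equation whose initial data has Fourier transform `g`. -/
def extension (g : E → ℂ) (t : ℝ) (x : E) : ℂ :=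
  ∫ ξ, phase (2 * Real.pi * inner ℝ ξ x - 4 * Real.pi ^ 2 * t * ‖ξ‖ ^ 2) * g ξ

theorem continuous_extension {g : E → ℂ} (hg : Integrable g) :
    Continuous fun p : ℝ × E => extension g p.1 p.2 :=
  continuous_integral_phase_mul
    (θ := fun (p : ℝ × E) ξ => 2 * Real.pi * inner ℝ ξ p.2 - 4 * Real.pi ^ 2 * p.1 * ‖ξ‖ ^ 2)
    (fun _ => by fun_prop) (fun _ => by fun_prop) hg

theorem extension_comp_linearIsometryEquiv {E' : Type*} [NormedAddCommGroup E']
    [InnerProductSpace ℝ E'] [FiniteDimensional ℝ E'] [MeasurableSpace E'] [BorelSpace E']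
    (e : E ≃ₗᵢ[ℝ] E') (g : E' → ℂ) (t : ℝ) (x : E) :
    extension (g ∘ e) t x = extension g t (e x) := by
  unfold extension
  rw [← e.measurePreserving.integral_comp e.toHomeomorph.measurableEmbedding]
  simp

theorem lintegral_extension_comp_linearIsometryEquiv {E' : Type*} [NormedAddCommGroup E']
    [InnerProductSpace ℝ E'] [FiniteDimensional ℝ E'] [MeasurableSpace E'] [BorelSpace E']
    (e : E ≃ₗᵢ[ℝ] E') (g : E' → ℂ) (t : ℝ) (n : ℕ) :
    ∫⁻ x, ‖extension (g ∘ e) t x‖ₑ ^ n = ∫⁻ x, ‖extension g t x‖ₑ ^ n := by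
  simp_rw [extension_comp_linearIsometryEquiv]
  exact e.measurePreserving.lintegral_comp_emb e.toHomeomorph.measurableEmbedding
    (fun x => ‖extension g t x‖ₑ ^ n)

end Extension

section Bilinear

/-- A shear translates every fibre. Factoring the coordinate changes below into shears, a swap and
one linear map of a plane reduces their Jacobians to that of the planar map. -/
theorem measurePreserving_add_fst {V W : Type*} [NormedAddCommGroup V] [NormedAddCommGroup W]
    [MeasureSpace V] [MeasureSpace W] [BorelSpace V] [BorelSpace W]
    [SecondCountableTopology V] [SecondCountableTopology W]
    [SFinite (volume : Measure V)] [SFinite (volume : Measure W)]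
    [(volume : Measure W).IsAddHaarMeasure] {f : V → W} (hf : Measurable f) :
    MeasurePreserving (fun p : V × W => (p.1, p.2 + f p.1)) (volume.prod volume)
      (volume.prod volume) := by
  refine (MeasurePreserving.id volume).skew_product (g := fun v w => w + f v) ?_ ?_
  · fun_prop
  · exact Filter.Eventually.of_forall fun v => map_add_right_eq_self _ _

/-- Coordinates on `ℂ × ℂ` given by the sum and the difference of the entries. -/
def sumDiff (p : ℂ × ℂ) : ℂ × ℂ :=
  ((2⁻¹ : ℝ) • p.2 + (2⁻¹ : ℝ) • p.1, p.1 - ((2⁻¹ : ℝ) • p.2 + (2⁻¹ : ℝ) • p.1))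

/-- The halving of the difference variable has real determinant `1/4` on `ℂ`; the other factors
preserve measure. -/
theorem map_sumDiff :
    ((volume : Measure ℂ).prod (volume : Measure ℂ)).map sumDiff =
      ENNReal.ofReal 4 • (volume.prod volume) := by
  have h1 : ((volume : Measure ℂ).prod (volume : Measure ℂ)).map
      (Prod.map id fun z => (2⁻¹ : ℝ) • z) = ENNReal.ofReal 4 • (volume.prod volume) := by
    rw [← Measure.map_prod_map _ _ measurable_id (by fun_prop),
      Measure.map_addHaar_smul _ (by norm_num), Measure.map_id, Measure.prod_smul_right,
      Complex.finrank_real_complex]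
    norm_num
  have h2 : MeasurePreserving (fun p : ℂ × ℂ => (p.1, p.2 + (2⁻¹ : ℝ) • p.1))
      (volume.prod volume) (volume.prod volume) := measurePreserving_add_fst (by fun_prop)
  have h3 : MeasurePreserving (fun p : ℂ × ℂ => (p.1, p.2 + -p.1))
      (volume.prod volume) (volume.prod volume) := measurePreserving_add_fst (by fun_prop)
  have h4 := h3.comp (Measure.measurePreserving_swap.comp h2)
  have h5 : sumDiff = ((fun p : ℂ × ℂ => (p.1, p.2 + -p.1)) ∘ Prod.swap ∘
      (fun p : ℂ × ℂ => (p.1, p.2 + (2⁻¹ : ℝ) • p.1))) ∘ Prod.map id fun z => (2⁻¹ : ℝ) • z := by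
    ext p <;> simp [sumDiff, sub_eq_add_neg]
  rw [h5, ← Measure.map_map h4.measurable (by fun_prop), h1, Measure.map_smul]
  congr 1
  exact h4.map_eq

theorem norm_sumDiff (p : ℂ × ℂ) : ‖(sumDiff p).1‖ ^ 2 + ‖(sumDiff p).2‖ ^ 2 =
    1 / 2 * ‖p.1‖ ^ 2 + 1 / 2 * ‖p.2‖ ^ 2 := by
  simp only [sumDiff, Complex.sq_norm, Complex.normSq_apply]
  simp
  ring

/-- The square of the extension is the extension of `g ⊗ g`. With `b = 1/2` and `c = 4`, the
constant `1/(2bc)` is `1/4`. -/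
theorem lintegral_extension_pow_four_le {g : ℂ → ℂ} (hg : Integrable g) :
    ∫⁻ t, ∫⁻ x, ‖extension g t x‖ₑ ^ 4 ≤ ENNReal.ofReal (1 / 4) * (∫⁻ ξ, ‖g ξ‖ₑ ^ 2) ^ 2 := by
  have h := lintegral_extension_le (T := sumDiff) (by unfold sumDiff; fun_prop) (by norm_num)
    map_sumDiff (S := fun ω : ℂ × ℂ => ω.1 + ω.2) (Q := fun ω => ‖ω.1‖ ^ 2 + ‖ω.2‖ ^ 2)
    (by fun_prop) (by fun_prop) (a := 1 / 2) (b := 1 / 2) (by norm_num)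
    (fun p => by simp [sumDiff]) norm_sumDiff (hg.mul_prod hg)
  have hu : ∀ t x, ∫ ω : ℂ × ℂ, phase (2 * Real.pi * inner ℝ (ω.1 + ω.2) x -
      4 * Real.pi ^ 2 * t * (‖ω.1‖ ^ 2 + ‖ω.2‖ ^ 2)) * (g ω.1 * g ω.2) ∂(volume.prod volume) =
      extension g t x ^ 2 := by
    intro t x
    rw [sq (extension g t x), extension, ← integral_prod_mul]
    congr with ω
    rw [mul_mul_mul_comm, ← phase_add, inner_add_left]
    ring_nf
  have hr : ∫⁻ ω : ℂ × ℂ, ‖g ω.1 * g ω.2‖ₑ ^ 2 ∂(volume.prod volume) =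
      (∫⁻ ξ, ‖g ξ‖ₑ ^ 2) ^ 2 := by
    have hm : AEMeasurable (fun ξ => ‖g ξ‖ₑ ^ 2) := hg.aestronglyMeasurable.enorm.pow_const 2
    rw [sq, ← lintegral_prod_mul hm hm]
    simp only [enorm_mul, mul_pow]
  simp_rw [hu, hr, enorm_pow, ← pow_mul] at h
  norm_num at h ⊢
  exact h

end Bilinear

section Trilinear

/-- Coordinates on `ℝ³` given by the sum of the entries and by the component orthogonal to the
diagonal. -/
def sumOrth (p : ℝ × ℂ) : (ℝ × ℝ) × ℝ :=
  ((p.2.re / √2 + p.2.im / √6 + p.1 / 3, -p.2.re / √2 + p.2.im / √6 + p.1 / 3),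
    p.1 - 2 * (p.2.im / √6 + p.1 / 3))

/-- These are the first two coordinates of `z` in the orthonormal frame `(1,-1,0)/√2`, `(1,1,-2)/√6`
of the plane orthogonal to the diagonal; the determinant is `2/√12 = 1/√3`. -/
theorem map_orthFrame : (volume : Measure ℂ).map
    (fun z => ((z.re / √2 + z.im / √6, -z.re / √2 + z.im / √6) : ℝ × ℝ)) =
      ENNReal.ofReal √3 • (volume.prod volume) := by
  set L := Matrix.toLin (Module.Basis.finTwoProd ℝ) (Module.Basis.finTwoProd ℝ)
    !![1 / √2, 1 / √6; -1 / √2, 1 / √6] with hL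
  have hdet : LinearMap.det L = (√3)⁻¹ := by
    rw [hL, LinearMap.det_toLin, Matrix.det_fin_two_of, show (6 : ℝ) = 2 * 3 by norm_num,
      Real.sqrt_mul (by norm_num)]
    have h2 : √2 * √2 = 2 := Real.mul_self_sqrt (by norm_num)
    field_simp
    nlinarith [h2]
  have h1 := Measure.map_linearMap_addHaar_eq_smul_addHaar
    ((volume : Measure ℝ).prod (volume : Measure ℝ)) (f := L) (by rw [hdet]; positivity)
  rw [hdet, inv_inv, abs_of_nonneg (Real.sqrt_nonneg _)] at h1
  have h2 := Complex.volume_preserving_equiv_real_prod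
  rw [← h1, ← Measure.volume_eq_prod, ← h2.map_eq,
    Measure.map_map (by exact L.continuous_of_finiteDimensional.measurable) h2.measurable]
  congr 1
  ext z <;> simp [hL, Complex.measurableEquivRealProd] <;> ring

theorem map_sumOrth :
    ((volume : Measure ℝ).prod (volume : Measure ℂ)).map sumOrth =
      ENNReal.ofReal √3 • ((volume.prod volume).prod volume) := by
  have h1 : ((volume : Measure ℝ).prod (volume : Measure ℂ)).map
      (Prod.map id fun z => ((z.re / √2 + z.im / √6, -z.re / √2 + z.im / √6) : ℝ × ℝ)) =
      ENNReal.ofReal √3 • (volume.prod volume) := by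
    rw [← Measure.map_prod_map _ _ measurable_id (by fun_prop), map_orthFrame, Measure.map_id,
      Measure.prod_smul_right, Measure.volume_eq_prod]
  have h2 : MeasurePreserving (fun p : ℝ × (ℝ × ℝ) => (p.1, p.2 + (p.1 / 3, p.1 / 3)))
      (volume.prod volume) (volume.prod volume) :=
    measurePreserving_add_fst (f := fun η : ℝ => ((η / 3, η / 3) : ℝ × ℝ)) (by fun_prop)
  have h3 : MeasurePreserving (fun p : (ℝ × ℝ) × ℝ => (p.1, p.2 + -(p.1.1 + p.1.2)))
      (volume.prod volume) (volume.prod volume) :=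
    measurePreserving_add_fst (f := fun v : ℝ × ℝ => -(v.1 + v.2)) (by fun_prop)
  have h4 := h3.comp (Measure.measurePreserving_swap.comp h2)
  have h5 : sumOrth = ((fun p : (ℝ × ℝ) × ℝ => (p.1, p.2 + -(p.1.1 + p.1.2))) ∘ Prod.swap ∘
      (fun p : ℝ × (ℝ × ℝ) => (p.1, p.2 + (p.1 / 3, p.1 / 3)))) ∘
      (Prod.map id fun z => ((z.re / √2 + z.im / √6, -z.re / √2 + z.im / √6) : ℝ × ℝ)) := by
    ext p
    · simp [sumOrth]
    · simp [sumOrth]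
    · simp [sumOrth]
      ring
  rw [h5, ← Measure.map_map h4.measurable (by fun_prop), h1, Measure.map_smul,
    ← Measure.volume_eq_prod ℝ ℝ]
  congr 1
  exact h4.map_eq

theorem norm_sumOrth (p : ℝ × ℂ) :
    ‖(sumOrth p).1.1‖ ^ 2 + ‖(sumOrth p).1.2‖ ^ 2 + ‖(sumOrth p).2‖ ^ 2 =
      1 / 3 * ‖p.1‖ ^ 2 + 1 * ‖p.2‖ ^ 2 := by
  simp only [sumOrth, Real.norm_eq_abs, sq_abs, Complex.sq_norm, Complex.normSq_apply]
  have h2 : √2 ^ 2 = 2 := Real.sq_sqrt (by norm_num)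
  have h6 : √6 ^ 2 = 6 := Real.sq_sqrt (by norm_num)
  have e2 : (p.2.re / √2) ^ 2 = p.2.re ^ 2 / 2 := by rw [div_pow, h2]
  have e6 : (p.2.im / √6) ^ 2 = p.2.im ^ 2 / 6 := by rw [div_pow, h6]
  rw [neg_div]
  linear_combination 2 * e2 + 6 * e6

/-- The cube of the extension is the extension of `g ⊗ g ⊗ g`; here `b = 1` and `c = √3`. -/
theorem lintegral_extension_pow_six_le {g : ℝ → ℂ} (hg : Integrable g) :
    ∫⁻ t, ∫⁻ x, ‖extension g t x‖ₑ ^ 6 ≤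
      ENNReal.ofReal (1 / (2 * √3)) * (∫⁻ ξ, ‖g ξ‖ₑ ^ 2) ^ 3 := by
  have h := lintegral_extension_le (T := sumOrth) (by unfold sumOrth; fun_prop)
    (c := √3) (by positivity)
    map_sumOrth (S := fun ω : (ℝ × ℝ) × ℝ => ω.1.1 + ω.1.2 + ω.2)
    (Q := fun ω => ‖ω.1.1‖ ^ 2 + ‖ω.1.2‖ ^ 2 + ‖ω.2‖ ^ 2)
    (by fun_prop) (by fun_prop) (a := 1 / 3) (b := 1) (by norm_num)
    (fun p => by simp only [sumOrth]; ring) norm_sumOrth ((hg.mul_prod hg).mul_prod hg)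
  have hu : ∀ t x, ∫ ω : (ℝ × ℝ) × ℝ, phase (2 * Real.pi * inner ℝ (ω.1.1 + ω.1.2 + ω.2) x -
      4 * Real.pi ^ 2 * t * (‖ω.1.1‖ ^ 2 + ‖ω.1.2‖ ^ 2 + ‖ω.2‖ ^ 2)) *
        (g ω.1.1 * g ω.1.2 * g ω.2) ∂((volume.prod volume).prod volume) =
      extension g t x ^ 3 := by
    intro t x
    rw [pow_succ (extension g t x), sq (extension g t x), extension, ← integral_prod_mul,
      ← integral_prod_mul]
    congr with ω
    rw [mul_mul_mul_comm (phase _), ← phase_add, mul_mul_mul_comm (phase _), ← phase_add,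
      inner_add_left, inner_add_left]
    ring_nf
  have hr : ∫⁻ ω : (ℝ × ℝ) × ℝ, ‖g ω.1.1 * g ω.1.2 * g ω.2‖ₑ ^ 2
      ∂((volume.prod volume).prod volume) = (∫⁻ ξ, ‖g ξ‖ₑ ^ 2) ^ 3 := by
    have hm : AEMeasurable (fun ξ => ‖g ξ‖ₑ ^ 2) := hg.aestronglyMeasurable.enorm.pow_const 2
    have hm2 : AEMeasurable (fun ω : ℝ × ℝ => ‖g ω.1‖ₑ ^ 2 * ‖g ω.2‖ₑ ^ 2)
        (volume.prod volume) := by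
      have := (hg.mul_prod hg).aestronglyMeasurable.enorm.pow_const 2
      simpa only [enorm_mul, mul_pow] using this
    rw [pow_succ, sq, ← lintegral_prod_mul hm hm, ← lintegral_prod_mul hm2 hm]
    simp only [enorm_mul, mul_pow]
  simp_rw [hu, hr, enorm_pow, ← pow_mul] at h
  norm_num at h ⊢
  exact h

end Trilinear
end

/-! ### Tensor products and the inequality for integrable Fourier data. -/

noncomputable section

theorem extension_prod (g : ℝ → ℂ) (t : ℝ) (x : ℂ) :
    extension (fun z : ℂ => g z.re * g z.im) t x = extension g t x.re * extension g t x.im := by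
  unfold extension
  rw [← integral_prod_mul, ← Measure.volume_eq_prod,
    ← Complex.volume_preserving_equiv_real_prod.integral_comp
      Complex.measurableEquivRealProd.measurableEmbedding]
  congr with z
  rw [mul_mul_mul_comm (phase _), ← phase_add, Complex.sq_norm, Complex.normSq_apply,
    Complex.inner]
  simp only [Complex.measurableEquivRealProd_apply, RCLike.inner_apply, conj_trivial,
    Real.norm_eq_abs, sq_abs, Complex.mul_re, Complex.conj_re, Complex.conj_im]
  ring_nf

theorem lintegral_complex_prod_mul {f : ℝ → ℝ≥0∞} (hf : AEMeasurable f) :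
    ∫⁻ z : ℂ, f z.re * f z.im = (∫⁻ x, f x) ^ 2 := by
  rw [sq, ← lintegral_prod_mul hf hf, ← Measure.volume_eq_prod,
    ← Complex.volume_preserving_equiv_real_prod.lintegral_comp_emb
      Complex.measurableEquivRealProd.measurableEmbedding]
  rfl

/-- The planar solution with data `g ⊗ g` is a tensor product at each time, so its spatial `L⁴`
integral is the square of the one-dimensional one. This raises the time exponent from `4` to `8`. -/
theorem lintegral_extension_four_sq_le {g : ℝ → ℂ} (hg : Integrable g) :
    ∫⁻ t, (∫⁻ x, ‖extension g t x‖ₑ ^ 4) ^ 2 ≤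
      ENNReal.ofReal (1 / 4) * (∫⁻ ξ, ‖g ξ‖ₑ ^ 2) ^ 4 := by
  have hgg : Integrable fun z : ℂ => g z.re * g z.im := by
    have h := hg.mul_prod hg
    rw [← Measure.volume_eq_prod] at h
    exact Complex.volume_preserving_equiv_real_prod.integrable_comp_of_integrable h
  have h := lintegral_extension_pow_four_le hgg
  have hm : AEMeasurable (fun ξ => ‖g ξ‖ₑ ^ 2) := hg.aestronglyMeasurable.enorm.pow_const 2
  have hu : ∀ t, AEMeasurable (fun x => ‖extension g t x‖ₑ ^ 4) := fun t =>
    (((continuous_extension hg).comp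
      (by fun_prop : Continuous fun x : ℝ => (t, x))).measurable.enorm.pow_const 4).aemeasurable
  simp_rw [extension_prod, enorm_mul, mul_pow] at h
  simp_rw [lintegral_complex_prod_mul (hu _)] at h
  rw [lintegral_complex_prod_mul hm, ← pow_mul] at h
  exact h

/-- The Strichartz inequality for the extension operator, that is, for data with integrable Fourier
transform. -/
def ExtensionInequality (p q : ℝ≥0) (d : ℕ) (C : ℝ) : Prop :=
  ∀ g : EuclideanSpace ℝ (Fin d) → ℂ, Integrable g →
    eLpNorm (fun t : ℝ => eLpNorm (extension g t) (p : ℝ≥0∞) volume) (q : ℝ≥0∞) volume ≤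
      ENNReal.ofReal C * eLpNorm g 2 volume

theorem eLpNorm_natCast_pow {X ε : Type*} [MeasurableSpace X] [TopologicalSpace ε]
    [ContinuousENorm ε] (μ : Measure X) (f : X → ε) {n : ℕ} (hn : n ≠ 0) :
    eLpNorm f ((n : ℝ≥0) : ℝ≥0∞) μ ^ n = ∫⁻ x, ‖f x‖ₑ ^ n ∂μ := by
  have := eLpNorm_nnreal_pow_eq_lintegral (μ := μ) (f := f) (p := (n : ℝ≥0)) (by simpa using hn)
  simpa using this

theorem eLpNorm_two_sq {X : Type*} [MeasurableSpace X] (μ : Measure X) (f : X → ℂ) :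
    eLpNorm f 2 μ ^ 2 = ∫⁻ x, ‖f x‖ₑ ^ 2 ∂μ := by
  simpa using eLpNorm_natCast_pow μ f (n := 2) (by norm_num)

theorem sharpConst_nonneg (p : ℝ≥0) (d : ℕ) : 0 ≤ sharpConst p d := by
  unfold sharpConst
  positivity

theorem sharpConst_six_one : sharpConst 6 1 ^ 6 = 1 / (2 * √3) := by
  unfold sharpConst
  rw [pow_one, mul_pow, ← Real.rpow_natCast, ← Real.rpow_natCast, ← Real.rpow_mul (by positivity),
    ← Real.rpow_mul (by positivity)]
  norm_num
  rw [show (6 : ℝ) = 2 * 3 by norm_num, Real.mul_rpow (by norm_num) (by norm_num),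
    Real.rpow_neg (by norm_num),
    Real.rpow_neg (by norm_num), ← Real.sqrt_eq_rpow, ← Real.sqrt_eq_rpow, mul_right_comm,
    ← mul_inv, Real.mul_self_sqrt (by norm_num)]
  ring

theorem sharpConst_four_two : sharpConst 4 2 ^ 4 = 1 / 4 := by
  unfold sharpConst
  rw [← pow_mul, mul_pow, ← Real.rpow_natCast, ← Real.rpow_natCast,
    ← Real.rpow_mul (by positivity), ← Real.rpow_mul (by positivity)]
  norm_num [Real.rpow_neg_one]

theorem sharpConst_four_one : sharpConst 4 1 ^ 8 = 1 / 4 := by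
  unfold sharpConst
  rw [← pow_mul, mul_pow, ← Real.rpow_natCast, ← Real.rpow_natCast,
    ← Real.rpow_mul (by positivity), ← Real.rpow_mul (by positivity)]
  norm_num [Real.rpow_neg_one]

theorem le_ofReal_mul_of_pow_le {A B : ℝ≥0∞} {C : ℝ} (hC : 0 ≤ C) {n : ℕ} (hn : n ≠ 0)
    (h : A ^ n ≤ ENNReal.ofReal (C ^ n) * B ^ n) : A ≤ ENNReal.ofReal C * B := by
  rw [ENNReal.ofReal_pow hC, ← mul_pow] at h
  exact (ENNReal.pow_right_strictMono hn).le_iff_le.1 h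

theorem extensionInequality_of_mem {p q : ℝ≥0} {d : ℕ}
    (hpqd : (p, q, d) ∈ ({(6, 6, 1), (4, 8, 1), (4, 4, 2)} : Set (ℝ≥0 × ℝ≥0 × ℕ))) :
    ExtensionInequality p q d (sharpConst p d) := by
  simp only [Set.mem_insert_iff, Set.mem_singleton_iff, Prod.mk.injEq] at hpqd
  intro g hg
  set e₁ : ℝ ≃ₗᵢ[ℝ] EuclideanSpace ℝ (Fin 1) := (OrthonormalBasis.singleton (Fin 1) ℝ).repr
  set e₂ : ℂ ≃ₗᵢ[ℝ] EuclideanSpace ℝ (Fin 2) := Complex.orthonormalBasisOneI.repr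
  rcases hpqd with ⟨rfl, rfl, rfl⟩ | ⟨rfl, rfl, rfl⟩ | ⟨rfl, rfl, rfl⟩
  · have hge : Integrable (g ∘ e₁) := e₁.measurePreserving.integrable_comp_of_integrable hg
    have h2 : ∫⁻ ξ, ‖(g ∘ e₁) ξ‖ₑ ^ 2 = ∫⁻ ξ, ‖g ξ‖ₑ ^ 2 :=
      e₁.measurePreserving.lintegral_comp_emb e₁.toHomeomorph.measurableEmbedding
        (fun x => ‖g x‖ₑ ^ 2)
    have h := lintegral_extension_pow_six_le hge
    simp_rw [lintegral_extension_comp_linearIsometryEquiv] at h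
    rw [h2, ← eLpNorm_two_sq, ← pow_mul] at h
    refine le_ofReal_mul_of_pow_le (sharpConst_nonneg _ _) (n := 6) (by norm_num) ?_
    rw [sharpConst_six_one, show (6 : ℝ≥0) = ((6 : ℕ) : ℝ≥0) by norm_num,
      eLpNorm_natCast_pow _ _ (by norm_num)]
    simpa only [enorm_eq_self, eLpNorm_natCast_pow volume (extension g _) (n := 6) (by norm_num)]
      using h
  · have hge : Integrable (g ∘ e₁) := e₁.measurePreserving.integrable_comp_of_integrable hg
    have h2 : ∫⁻ ξ, ‖(g ∘ e₁) ξ‖ₑ ^ 2 = ∫⁻ ξ, ‖g ξ‖ₑ ^ 2 :=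
      e₁.measurePreserving.lintegral_comp_emb e₁.toHomeomorph.measurableEmbedding
        (fun x => ‖g x‖ₑ ^ 2)
    have h := lintegral_extension_four_sq_le hge
    simp_rw [lintegral_extension_comp_linearIsometryEquiv] at h
    rw [h2, ← eLpNorm_two_sq, ← pow_mul] at h
    refine le_ofReal_mul_of_pow_le (sharpConst_nonneg _ _) (n := 8) (by norm_num) ?_
    rw [sharpConst_four_one, show (8 : ℝ≥0) = ((8 : ℕ) : ℝ≥0) by norm_num,
      show (4 : ℝ≥0) = ((4 : ℕ) : ℝ≥0) by norm_num, eLpNorm_natCast_pow _ _ (by norm_num)]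
    have h8 : ∀ t, ‖eLpNorm (extension g t) (((4 : ℕ) : ℝ≥0) : ℝ≥0∞) volume‖ₑ ^ 8 =
        (∫⁻ x, ‖extension g t x‖ₑ ^ 4) ^ 2 := fun t => by
      rw [enorm_eq_self, show 8 = 4 * 2 by norm_num, pow_mul, eLpNorm_natCast_pow _ _ (by norm_num)]
    simp_rw [h8]
    exact h
  · have hge : Integrable (g ∘ e₂) := e₂.measurePreserving.integrable_comp_of_integrable hg
    have h2 : ∫⁻ ξ, ‖(g ∘ e₂) ξ‖ₑ ^ 2 = ∫⁻ ξ, ‖g ξ‖ₑ ^ 2 :=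
      e₂.measurePreserving.lintegral_comp_emb e₂.toHomeomorph.measurableEmbedding
        (fun x => ‖g x‖ₑ ^ 2)
    have h := lintegral_extension_pow_four_le hge
    simp_rw [lintegral_extension_comp_linearIsometryEquiv] at h
    rw [h2, ← eLpNorm_two_sq, ← pow_mul] at h
    refine le_ofReal_mul_of_pow_le (sharpConst_nonneg _ _) (n := 4) (by norm_num) ?_
    rw [sharpConst_four_two, show (4 : ℝ≥0) = ((4 : ℕ) : ℝ≥0) by norm_num,
      eLpNorm_natCast_pow _ _ (by norm_num)]
    simpa only [enorm_eq_self, eLpNorm_natCast_pow volume (extension g _) (n := 4) (by norm_num)]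
      using h

end

/-! ### Passage to arbitrary `L²` data. -/

noncomputable section

open Filter Topology

/-- Fatou needs almost everywhere convergence, which `L²` convergence gives only along a
subsequence. Hence a subsequence with norms below a level just above the liminf is chosen first, and
a further one converges almost everywhere. -/
theorem eLpNorm_le_liminf_of_tendsto {X : Type*} [MeasurableSpace X] {μ : Measure X}
    {u : ℕ → Lp ℂ 2 μ} {v : Lp ℂ 2 μ} (h : Tendsto u atTop (𝓝 v)) (p : ℝ≥0∞) :
    eLpNorm v p μ ≤ liminf (fun n => eLpNorm (u n) p μ) atTop := by
  refine le_of_forall_gt fun b hb => ?_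
  obtain ⟨c, hc, hcb⟩ := exists_between hb
  obtain ⟨φ, hφ, hφc⟩ :=
    extraction_of_frequently_atTop (frequently_lt_of_liminf_lt (by isBoundedDefault) hc)
  obtain ⟨ns, -, hns⟩ :=
    (tendstoInMeasure_of_tendsto_Lp (h.comp hφ.tendsto_atTop)).exists_seq_tendsto_ae
  refine (Lp.eLpNorm_lim_le_liminf_eLpNorm (fun n => Lp.aestronglyMeasurable (u (φ (ns n)))) _
    hns).trans_lt (lt_of_le_of_lt ?_ hcb)
  exact liminf_le_of_le (by isBoundedDefault) fun a ha => by
    obtain ⟨n, hn⟩ := ha.exists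
    exact hn.trans (hφc (ns n)).le

/-- The Schrödinger propagator is an integral if the Fourier transform of the data is
integrable. -/
theorem schrodingerPropagator_fourierInv_toLp {d : ℕ} {ψ : EuclideanSpace ℝ (Fin d) → ℂ}
    (hψ : Integrable ψ) (hψ2 : MemLp ψ 2 volume) (t : ℝ) :
    schrodingerPropagator t (𝓕⁻ (hψ2.toLp ψ) : L2Space d) =ᵐ[volume] extension ψ t := by
  have hm : MemLp (fun ξ => schrodingerSymbol t ξ * ψ ξ) 2 volume := by
    refine hψ2.of_le
      ((continuous_schrodingerSymbol t).aestronglyMeasurable.mul hψ2.aestronglyMeasurable) ?_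
    filter_upwards with ξ
    rw [norm_mul, norm_schrodingerSymbol, one_mul]
  have hi : Integrable (fun ξ => schrodingerSymbol t ξ * ψ ξ) :=
    integrable_phase_mul (by fun_prop) hψ
  have heq : schrodingerPropagator t (𝓕⁻ (hψ2.toLp ψ) : L2Space d) = 𝓕⁻ (hm.toLp _) := by
    unfold schrodingerPropagator
    congr 1
    refine MemLp.toLp_congr _ _ ?_
    rw [FourierTransform.fourier_fourierInv_eq]
    filter_upwards [hψ2.coeFn_toLp] with ξ hξ
    rw [hξ]
  rw [heq]
  refine (fourierInv_toLp_ae_eq hi hm).trans (Eventually.of_forall fun x => ?_)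
  rw [fourierInv_eq_integral_phase, extension]
  congr with ξ
  rw [← mul_assoc]
  change _ * phase _ * _ = _
  rw [← phase_add]
  ring_nf

theorem schrodingerPropagator_sub {d : ℕ} (t : ℝ) (f g : L2Space d) :
    schrodingerPropagator t (f - g) = schrodingerPropagator t f - schrodingerPropagator t g := by
  unfold schrodingerPropagator
  change (Lp.fourierTransformₗᵢ _ ℂ).symm _ =
    (Lp.fourierTransformₗᵢ _ ℂ).symm _ - (Lp.fourierTransformₗᵢ _ ℂ).symm _
  rw [← map_sub, ← MemLp.toLp_sub]
  congr 1
  refine MemLp.toLp_congr _ _ ?_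
  have h : (𝓕 (f - g) : L2Space d) = 𝓕 f - 𝓕 g := map_sub (Lp.fourierTransformₗᵢ _ ℂ) f g
  rw [h]
  filter_upwards [Lp.coeFn_sub (𝓕 f : L2Space d) (𝓕 g)] with ξ hξ
  rw [hξ, Pi.sub_apply, Pi.sub_apply, mul_sub]

theorem norm_schrodingerPropagator {d : ℕ} (t : ℝ) (f : L2Space d) :
    ‖schrodingerPropagator t f‖ = ‖f‖ := by
  unfold schrodingerPropagator
  rw [← Lp.norm_fourier_eq, FourierTransform.fourier_fourierInv_eq, ← Lp.norm_fourier_eq f,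
    Lp.norm_toLp, Lp.norm_def]
  congr 1
  refine eLpNorm_congr_norm_ae (Eventually.of_forall fun ξ => ?_)
  rw [norm_mul, norm_schrodingerSymbol, one_mul]

theorem isometry_schrodingerPropagator {d : ℕ} (t : ℝ) :
    Isometry (schrodingerPropagator t : L2Space d → L2Space d) := by
  refine Isometry.of_dist_eq fun f g => ?_
  rw [dist_eq_norm, dist_eq_norm, ← schrodingerPropagator_sub, norm_schrodingerPropagator]

theorem eLpNorm_two_fourierInv_toLp {d : ℕ} {ψ : EuclideanSpace ℝ (Fin d) → ℂ}
    (hψ : MemLp ψ 2 volume) :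
    eLpNorm (𝓕⁻ (hψ.toLp ψ) : L2Space d) 2 volume = eLpNorm ψ 2 volume := by
  rw [← Lp.enorm_def, ← Lp.enorm_toLp (hf := hψ), ← ofReal_norm, ← ofReal_norm,
    ← Lp.norm_fourier_eq, FourierTransform.fourier_fourierInv_eq]

theorem measurable_eLpNorm_extension {d : ℕ} {ψ : EuclideanSpace ℝ (Fin d) → ℂ}
    (hψ : Integrable ψ) {p : ℝ≥0} (hp : p ≠ 0) :
    Measurable fun t => eLpNorm (extension ψ t) p volume := by
  simp_rw [eLpNorm_nnreal_eq_lintegral hp]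
  refine Measurable.pow_const (Measurable.lintegral_prod_right'
    (f := fun q : ℝ × EuclideanSpace ℝ (Fin d) => ‖extension ψ q.1 q.2‖ₑ ^ (p : ℝ)) ?_) _
  exact (continuous_extension hψ).measurable.enorm.pow_const _

/-- The Fourier transform of `f` is approximated in `L²` by Schwartz functions. Lower semicontinuity
is used in `x` at every time, then Fatou in `t`; only the approximants need to be measurable in `t`.
-/
theorem strichartzInequality_of_extensionInequality {p q : ℝ≥0} {d : ℕ} {C : ℝ} (hp : p ≠ 0)
    (hq : q ≠ 0) (h : ExtensionInequality p q d C) : StrichartzInequality p q d C := by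
  intro f
  obtain ⟨v, hv, hvlim⟩ := mem_closure_iff_seq_limit.1
    (SchwartzMap.denseRange_toLpCLM (p := 2) (F := ℂ) (μ := volume) ENNReal.ofNat_ne_top (𝓕 f))
  choose φ hφ using hv
  have hφi : ∀ n, Integrable (φ n) := fun n => (φ n).integrable
  have hφ2 : ∀ n, MemLp (φ n) 2 volume := fun n => (φ n).memLp 2
  set u : ℕ → L2Space d := fun n => 𝓕⁻ ((hφ2 n).toLp (φ n))
  have hv' : ∀ n, v n = (hφ2 n).toLp (φ n) := fun n => (hφ n).symm
  have hlim : Tendsto u atTop (𝓝 f) := by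
    have := ((Lp.fourierTransformₗᵢ (EuclideanSpace ℝ (Fin d)) ℂ).symm.continuous.tendsto
      (𝓕 f)).comp hvlim
    have hf : (Lp.fourierTransformₗᵢ (EuclideanSpace ℝ (Fin d)) ℂ).symm (𝓕 f) = f :=
      (Lp.fourierTransformₗᵢ (EuclideanSpace ℝ (Fin d)) ℂ).symm_apply_apply f
    rw [hf] at this
    refine this.congr fun n => ?_
    rw [Function.comp_apply, hv']
    rfl
  have hnorm : Tendsto (fun n => eLpNorm (φ n) 2 volume) atTop (𝓝 (eLpNorm f 2 volume)) := by
    have : ∀ n, eLpNorm (φ n) 2 volume = ‖u n‖ₑ := fun n => by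
      rw [Lp.enorm_def, eLpNorm_two_fourierInv_toLp]
    simp_rw [this, ← Lp.enorm_def]
    exact hlim.enorm
  have hlsc : ∀ t, eLpNorm (schrodingerPropagator t f) p volume ≤
      liminf (fun n => eLpNorm (extension (φ n) t) p volume) atTop := fun t => by
    refine (eLpNorm_le_liminf_of_tendsto
      (((isometry_schrodingerPropagator t).continuous.tendsto f).comp hlim) p).trans_eq ?_
    congr with n
    exact eLpNorm_congr_ae (schrodingerPropagator_fourierInv_toLp (hφi n) (hφ2 n) t)
  have hq' : (0 : ℝ) < q := by positivity
  unfold strichartzNorm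
  rw [← ENNReal.rpow_le_rpow_iff hq', eLpNorm_nnreal_pow_eq_lintegral hq]
  calc _ ≤ ∫⁻ t : ℝ, liminf (fun n => eLpNorm (extension (φ n) t) p volume ^ (q : ℝ)) atTop := by
        refine lintegral_mono fun t => ?_
        rw [enorm_eq_self]
        refine (ENNReal.rpow_le_rpow (hlsc t) hq'.le).trans_eq ?_
        exact (ENNReal.monotone_rpow_of_nonneg hq'.le).map_liminf_of_continuousAt _
          ENNReal.continuous_rpow_const.continuousAt
    _ ≤ liminf (fun n => ∫⁻ t : ℝ, eLpNorm (extension (φ n) t) p volume ^ (q : ℝ)) atTop :=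
        lintegral_liminf_le fun n => (measurable_eLpNorm_extension (hφi n) hp).pow_const _
    _ ≤ liminf (fun n => (ENNReal.ofReal C * eLpNorm (φ n) 2 volume) ^ (q : ℝ)) atTop := by
        refine liminf_le_liminf (Eventually.of_forall fun n => ?_)
        have := ENNReal.rpow_le_rpow (h (φ n) (hφi n)) hq'.le
        rwa [eLpNorm_nnreal_pow_eq_lintegral hq] at this
    _ = _ := by
        refine Tendsto.liminf_eq ?_
        exact ((ENNReal.Tendsto.const_mul hnorm (Or.inr ENNReal.ofReal_ne_top)).ennrpow_const _)

end

/-! ### Gaussians: norms, evolution and the sharp constant. -/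

noncomputable section

open Filter Topology

section Gaussian

variable {d : ℕ}

theorem norm_gaussianFun (A B : ℂ) (u : Fin d → ℂ) (x : EuclideanSpace ℝ (Fin d)) :
    ‖gaussianFun A B u x‖ = ‖A‖ * Real.exp (-B.re * ‖x‖ ^ 2 + ∑ j, (u j).re * x j) := by
  rw [gaussianFun, norm_mul, Complex.norm_exp, Complex.add_re, Complex.re_sum]
  simp only [Complex.re_mul_ofReal, Complex.neg_re]

theorem gaussianFun_eq_comp (A B : ℂ) (u : Fin d → ℂ) (x : EuclideanSpace ℝ (Fin d)) :
    gaussianFun A B u x =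
      A * Complex.exp (-B * ∑ i, (x i : ℂ) ^ 2 + ∑ i, u i * x i) := by
  rw [gaussianFun, EuclideanSpace.norm_sq_eq]
  simp

theorem integral_gaussianFun (A : ℂ) {B : ℂ} (hB : 0 < B.re) (u : Fin d → ℂ) :
    ∫ x, gaussianFun A B u x =
      A * ((Real.pi / B) ^ (d / 2 : ℂ) * Complex.exp ((∑ i, u i ^ 2) / (4 * B))) := by
  have h := GaussianFourier.integral_cexp_neg_mul_sum_add hB u
  rw [Fintype.card_fin] at h
  rw [← h, ← (PiLp.volume_preserving_toLp (Fin d)).integral_comp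
    (MeasurableEquiv.toLp 2 _).measurableEmbedding, ← integral_const_mul]
  simp only [gaussianFun_eq_comp]

theorem integrable_gaussianFun (A : ℂ) {B : ℂ} (hB : 0 < B.re) (u : Fin d → ℂ) :
    Integrable (gaussianFun A B u) := by
  have h := (GaussianFourier.integrable_cexp_neg_mul_sum_add hB u).const_mul A
  rw [← (PiLp.volume_preserving_toLp (Fin d)).integrable_comp_emb
    (MeasurableEquiv.toLp 2 _).measurableEmbedding]
  refine h.congr (Eventually.of_forall fun x => ?_)
  simp only [Function.comp_apply, gaussianFun_eq_comp]

/-- The power `p` of the modulus is again a Gaussian, with real parameters `‖A‖^p`, `p Re B` and `p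
Re u`. -/
theorem lintegral_norm_gaussianFun_rpow (A : ℂ) {B : ℂ} (hB : 0 < B.re) (u : Fin d → ℂ) {p : ℝ}
    (hp : 0 < p) :
    ∫⁻ x, ‖gaussianFun A B u x‖ₑ ^ p = ENNReal.ofReal (‖A‖ ^ p *
      ((Real.pi / (p * B.re)) ^ (d / 2 : ℝ) *
        Real.exp (p * ((∑ i, (u i).re ^ 2) / (4 * B.re))))) := by
  set v : Fin d → ℂ := fun i => ((p * (u i).re : ℝ) : ℂ)
  set b : ℂ := ((p * B.re : ℝ) : ℂ) with hb
  have hbre : 0 < b.re := by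
    rw [hb, Complex.ofReal_re]
    positivity
  have hpt : ∀ x, gaussianFun ((‖A‖ ^ p : ℝ) : ℂ) b v x =
      ((‖gaussianFun A B u x‖ ^ p : ℝ) : ℂ) := by
    intro x
    rw [norm_gaussianFun, Real.mul_rpow (by positivity) (by positivity), ← Real.exp_mul,
      gaussianFun, Complex.ofReal_mul, Complex.ofReal_exp]
    congr 2
    simp only [v, hb]
    push_cast
    rw [add_mul, Finset.sum_mul]
    congr 1
    · ring
    · exact Finset.sum_congr rfl fun i _ => by ring
  have hi : Integrable fun x => ‖gaussianFun A B u x‖ ^ p := by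
    have := (integrable_gaussianFun ((‖A‖ ^ p : ℝ) : ℂ) hbre v).re
    simpa [hpt] using this
  have hint : ∫ x, ‖gaussianFun A B u x‖ ^ p = ‖A‖ ^ p *
      ((Real.pi / (p * B.re)) ^ (d / 2 : ℝ) *
        Real.exp (p * ((∑ i, (u i).re ^ 2) / (4 * B.re)))) := by
    have h := integral_gaussianFun ((‖A‖ ^ p : ℝ) : ℂ) hbre v
    simp_rw [hpt] at h
    rw [integral_complex_ofReal] at h
    refine Complex.ofReal_injective (h.trans ?_)
    rw [Complex.ofReal_mul, Complex.ofReal_mul,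
      Complex.ofReal_cpow (x := Real.pi / (p * B.re)) (by positivity), Complex.ofReal_exp]
    simp only [v, hb]
    push_cast
    congr 3
    simp_rw [mul_pow]
    rw [← Finset.mul_sum]
    have : (p : ℂ) ≠ 0 := by exact_mod_cast hp.ne'
    have : (B.re : ℂ) ≠ 0 := by exact_mod_cast hB.ne'
    field_simp
  rw [← hint, ofReal_integral_eq_lintegral_ofReal hi (Eventually.of_forall fun _ => by positivity)]
  refine lintegral_congr fun x => ?_
  rw [← ofReal_norm, ENNReal.ofReal_rpow_of_nonneg (norm_nonneg _) hp.le]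

theorem eLpNorm_gaussianFun (A : ℂ) {B : ℂ} (hB : 0 < B.re) (u : Fin d → ℂ) {p : ℝ≥0}
    (hp : p ≠ 0) :
    eLpNorm (gaussianFun A B u) p volume = ENNReal.ofReal
      (‖A‖ * Real.exp ((∑ i, (u i).re ^ 2) / (4 * B.re)) *
        (Real.pi / (p * B.re)) ^ (d / (2 * p) : ℝ)) := by
  have hp' : (0 : ℝ) < p := by positivity
  rw [eLpNorm_nnreal_eq_lintegral hp, lintegral_norm_gaussianFun_rpow A hB u hp',
    ENNReal.ofReal_rpow_of_nonneg (by positivity) (by positivity)]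
  congr 1
  rw [Real.mul_rpow (by positivity) (by positivity), Real.mul_rpow (by positivity) (by positivity),
    ← Real.rpow_mul (by positivity), ← Real.rpow_mul (by positivity), ← Real.exp_mul,
    mul_one_div_cancel hp'.ne', Real.rpow_one, mul_assoc ‖A‖]
  congr 1
  rw [mul_comm]
  congr 2
  · field_simp
  · field_simp

theorem memLp_gaussianFun (A : ℂ) {B : ℂ} (hB : 0 < B.re) (u : Fin d → ℂ) :
    MemLp (gaussianFun A B u) 2 volume := by
  refine ⟨(integrable_gaussianFun A hB u).aestronglyMeasurable, ?_⟩
  have := eLpNorm_gaussianFun A hB u (p := 2) (by norm_num)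
  rw [ENNReal.coe_ofNat] at this
  rw [this]
  exact ENNReal.ofReal_lt_top

/-- The amplitude and the linear term enter both norms through the same factor, so the ratio depends
only on `Re B`; `A` and `u` need not be tracked along the flow. -/
theorem eLpNorm_gaussianFun_eq_mul (A : ℂ) {B : ℂ} (hB : 0 < B.re) (u : Fin d → ℂ) {p : ℝ≥0}
    (hp : p ≠ 0) :
    eLpNorm (gaussianFun A B u) p volume = ENNReal.ofReal
      ((Real.pi / (p * B.re)) ^ (d / (2 * p) : ℝ) * (Real.pi / (2 * B.re)) ^ (-(d / 4) : ℝ)) *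
        eLpNorm (gaussianFun A B u) 2 volume := by
  have := eLpNorm_gaussianFun A hB u (p := 2) (by norm_num)
  rw [ENNReal.coe_ofNat] at this
  rw [this, eLpNorm_gaussianFun A hB u hp, ← ENNReal.ofReal_mul (by positivity)]
  congr 1
  rw [Real.rpow_neg (by positivity), NNReal.coe_ofNat, show (2 * 2 : ℝ) = 4 by norm_num]
  have : (Real.pi / (2 * B.re)) ^ (d / 4 : ℝ) ≠ 0 := by positivity
  field_simp

theorem fourierInv_gaussianFun (A : ℂ) {B : ℂ} (hB : 0 < B.re) (u : Fin d → ℂ) :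
    𝓕⁻ (gaussianFun A B u) = gaussianFun
      (A * ((Real.pi / B) ^ (d / 2 : ℂ) * Complex.exp ((∑ i, u i ^ 2) / (4 * B))))
      (Real.pi ^ 2 / B) (fun j => Real.pi * Complex.I / B * u j) := by
  have hB0 : B ≠ 0 := fun h => by simp [h] at hB
  ext x
  have h := integral_gaussianFun A hB (fun j => u j + 2 * Real.pi * Complex.I * x j)
  rw [fourierInv_eq_integral_phase]
  have hpt : ∀ ξ, phase (2 * Real.pi * inner ℝ ξ x) * gaussianFun A B u ξ =
      gaussianFun A B (fun j => u j + 2 * Real.pi * Complex.I * x j) ξ := fun ξ => by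
    rw [phase, gaussianFun, gaussianFun, mul_left_comm, ← Complex.exp_add, PiLp.inner_apply]
    congr 2
    simp only [RCLike.inner_apply, conj_trivial, add_mul, Finset.sum_add_distrib]
    push_cast
    rw [Finset.mul_sum, Finset.mul_sum, add_comm, add_assoc]
    congr 2
    exact Finset.sum_congr rfl fun i _ => by ring
  simp_rw [hpt]
  rw [h, gaussianFun_eq_comp, mul_assoc A, mul_assoc ((Real.pi / B) ^ (d / 2 : ℂ)),
    ← Complex.exp_add]
  congr 3
  rw [Finset.sum_div, Finset.sum_div, Finset.mul_sum, ← Finset.sum_add_distrib,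
    ← Finset.sum_add_distrib]
  refine Finset.sum_congr rfl fun i _ => ?_
  field_simp
  linear_combination (4 * Real.pi ^ 2 * (x i : ℂ) ^ 2) * Complex.I_sq

theorem re_inv_pos {B : ℂ} (hB : 0 < B.re) : 0 < (B⁻¹).re := by
  have hB0 : B ≠ 0 := fun h => by simp [h] at hB
  rw [Complex.inv_re]
  exact div_pos hB (Complex.normSq_pos.2 hB0)

theorem exists_fourierInv_eq_gaussianFun (A : ℂ) {B : ℂ} (hB : 0 < B.re) (u : Fin d → ℂ) :
    ∃ A' u', 𝓕⁻ (gaussianFun A' (Real.pi ^ 2 * B⁻¹) u') = gaussianFun A B u := by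
  have hB0 : B ≠ 0 := fun h => by simp [h] at hB
  have hpi : (Real.pi : ℂ) ≠ 0 := by exact_mod_cast Real.pi_ne_zero
  have hB' : 0 < (Real.pi ^ 2 * B⁻¹ : ℂ).re := by
    rw [← Complex.ofReal_pow, Complex.re_ofReal_mul]
    have := re_inv_pos hB
    positivity
  set B' : ℂ := Real.pi ^ 2 * B⁻¹ with hB'def
  have hB'0 : B' ≠ 0 := by positivity
  set u' : Fin d → ℂ := fun j => -(Real.pi * Complex.I * B⁻¹) * u j with hu'
  set c : ℂ := (Real.pi / B') ^ (d / 2 : ℂ) * Complex.exp ((∑ i, u' i ^ 2) / (4 * B'))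
  have hc : c ≠ 0 := by
    refine mul_ne_zero ?_ (Complex.exp_ne_zero _)
    rw [Complex.cpow_def_of_ne_zero (div_ne_zero hpi hB'0)]
    exact Complex.exp_ne_zero _
  refine ⟨A / c, u', ?_⟩
  rw [fourierInv_gaussianFun _ hB', div_mul_cancel₀ _ hc]
  congr 1
  · rw [hB'def]
    field_simp
  · ext j
    rw [hu', hB'def]
    field_simp
    linear_combination (-(u j)) * Complex.I_sq

/-- On the Fourier side the parameter is `π²B⁻¹`, and the symbol adds `4π²it` to it; inverting the
transform gives the new parameter. -/
theorem schrodingerPropagator_gaussianFun (A : ℂ) {B : ℂ} (hB : 0 < B.re) (u : Fin d → ℂ)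
    (t : ℝ) : ∃ A' u', schrodingerPropagator t ((memLp_gaussianFun A hB u).toLp _) =ᵐ[volume]
      gaussianFun A' (B⁻¹ + 4 * t * Complex.I)⁻¹ u' := by
  obtain ⟨A₁, u₁, h₁⟩ := exists_fourierInv_eq_gaussianFun A hB u
  have hB₁ : 0 < (Real.pi ^ 2 * B⁻¹ : ℂ).re := by
    rw [← Complex.ofReal_pow, Complex.re_ofReal_mul]
    have := re_inv_pos hB
    positivity
  have hB₂ : 0 < (Real.pi ^ 2 * (B⁻¹ + 4 * t * Complex.I) : ℂ).re := by
    rw [← Complex.ofReal_pow, Complex.re_ofReal_mul]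
    have h0 := re_inv_pos hB
    have h1 : (B⁻¹ + 4 * t * Complex.I).re = (B⁻¹).re := by simp
    rw [h1]
    positivity
  have hψ := integrable_gaussianFun A₁ hB₁ u₁
  have hψ2 := memLp_gaussianFun A₁ hB₁ u₁
  have hf : (memLp_gaussianFun A hB u).toLp _ = 𝓕⁻ (hψ2.toLp _) := by
    refine Lp.ext ?_
    refine (MemLp.coeFn_toLp _).trans ((fourierInv_toLp_ae_eq hψ hψ2).trans ?_).symm
    rw [h₁]
  have hext : extension (gaussianFun A₁ (Real.pi ^ 2 * B⁻¹) u₁) t =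
      𝓕⁻ (gaussianFun A₁ (Real.pi ^ 2 * (B⁻¹ + 4 * t * Complex.I)) u₁) := by
    ext x
    rw [fourierInv_eq_integral_phase, extension]
    congr with ξ
    rw [sub_eq_add_neg, phase_add, mul_assoc]
    congr 1
    rw [phase, gaussianFun, gaussianFun, mul_left_comm, ← Complex.exp_add]
    congr 2
    push_cast
    ring
  rw [hf]
  have key := schrodingerPropagator_fourierInv_toLp hψ hψ2 t
  have hpi : (Real.pi : ℂ) ^ 2 ≠ 0 := by exact_mod_cast pow_ne_zero 2 Real.pi_ne_zero
  have hinv : (Real.pi ^ 2 / (Real.pi ^ 2 * (B⁻¹ + 4 * t * Complex.I)) : ℂ) =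
      (B⁻¹ + 4 * t * Complex.I)⁻¹ := by
    rw [div_mul_eq_div_div, div_self hpi, one_div]
  rw [hext, fourierInv_gaussianFun _ hB₂, hinv] at key
  exact ⟨_, _, key⟩

/-- The integrand is a translated and dilated multiple of `1/(1 + s²)`; the dilation cancels `Re z`.
-/
theorem lintegral_re_inv_add {z : ℂ} (hz : 0 < z.re) :
    ∫⁻ t : ℝ, ENNReal.ofReal ((z + 4 * t * Complex.I)⁻¹).re = ENNReal.ofReal (Real.pi / 4) := by
  set F : ℝ → ℝ≥0∞ := fun s => ENNReal.ofReal (1 + s ^ 2)⁻¹ with hF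
  have hFm : Measurable F := by fun_prop
  have hFi : ∫⁻ s, F s = ENNReal.ofReal Real.pi := by
    rw [← integral_univ_inv_one_add_sq, ofReal_integral_eq_lintegral_ofReal
      integrable_inv_one_add_sq (Eventually.of_forall fun _ => by positivity)]
  have hpt : ∀ t : ℝ, ENNReal.ofReal ((z + 4 * t * Complex.I)⁻¹).re =
      ENNReal.ofReal z.re⁻¹ * F (4 / z.re * (t + z.im / 4)) := fun t => by
    rw [hF, ← ENNReal.ofReal_mul (by positivity), Complex.inv_re, Complex.normSq_apply]
    congr 1
    simp
    field_simp
    ring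
  simp_rw [hpt]
  rw [lintegral_const_mul _ (by fun_prop),
    lintegral_add_right_eq_self (fun t => F (4 / z.re * t)) (z.im / 4),
    lintegral_comp_mul_left_real hFm (by positivity), hFi, ← ENNReal.ofReal_mul (by positivity),
    ← ENNReal.ofReal_mul (by positivity), abs_of_pos (by positivity)]
  congr 1
  field_simp

/-- The scaling relation between `p`, `q` and `d` makes the total power of `β` equal to `1/q`, so
that the power `q` of the ratio is linear in `β`. -/
theorem gaussian_const_eq {p q : ℝ} (hp : 0 < p)
    (hpq : 1 / q = d / 4 - d / (2 * p)) {β : ℝ} (hβ : 0 < β) :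
    (Real.pi / (p * β)) ^ (d / (2 * p) : ℝ) * (Real.pi / (2 * β)) ^ (-(d / 4) : ℝ) =
      ((Real.pi / p) ^ (d / (2 * p) : ℝ) * (Real.pi / 2) ^ (-(d / 4) : ℝ)) * β ^ (1 / q) := by
  rw [hpq, ← div_div Real.pi, ← div_div Real.pi, Real.div_rpow (by positivity) hβ.le,
    Real.div_rpow (by positivity) hβ.le, Real.rpow_neg hβ.le, Real.rpow_sub hβ]
  field_simp

theorem sharpConst_eq {p q : ℝ≥0} (hp : p ≠ 0) (hpq : 1 / (q : ℝ) = d / 4 - d / (2 * p)) :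
    (Real.pi / p) ^ (d / (2 * p) : ℝ) * (Real.pi / 2) ^ (-(d / 4) : ℝ) *
      (Real.pi / 4) ^ (1 / (q : ℝ)) = sharpConst p d := by
  have hp' : (0 : ℝ) < p := by positivity
  have hpi := Real.pi_pos
  rw [hpq, sharpConst, ← Real.rpow_natCast]
  -- After taking logarithms, the identity is linear in `log π`, `log p` and `log 2`, and the `log
  -- π` terms cancel.
  refine Real.log_injOn_pos (Set.mem_Ioi.2 (by positivity)) (Set.mem_Ioi.2 (by positivity)) ?_
  rw [Real.log_mul (by positivity) (by positivity), Real.log_mul (by positivity) (by positivity),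
    Real.log_rpow (by positivity), Real.log_rpow (by positivity), Real.log_rpow (by positivity),
    Real.log_rpow (by positivity), Real.log_mul (by positivity) (by positivity),
    Real.log_rpow hp', Real.log_rpow (by positivity), Real.log_div hpi.ne' hp'.ne',
    Real.log_div hpi.ne' (by norm_num), Real.log_div hpi.ne' (by norm_num),
    show (4 : ℝ) = 2 ^ 2 by norm_num, Real.log_pow]
  push_cast
  field_simp
  ring

theorem strichartzNorm_gaussianFun (A : ℂ) {B : ℂ} (hB : 0 < B.re) (u : Fin d → ℂ) {p q : ℝ≥0}
    (hp : p ≠ 0) (hq : q ≠ 0) (hpq : 1 / (q : ℝ) = d / 4 - d / (2 * p)) :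
    strichartzNorm p q ((memLp_gaussianFun A hB u).toLp _) =
      ENNReal.ofReal (sharpConst p d) *
        eLpNorm ((memLp_gaussianFun A hB u).toLp _) 2 volume := by
  set f : L2Space d := (memLp_gaussianFun A hB u).toLp _
  set K : ℝ := (Real.pi / p) ^ (d / (2 * p) : ℝ) * (Real.pi / 2) ^ (-(d / 4) : ℝ)
  have hK : 0 ≤ K := by positivity
  have hp' : (0 : ℝ) < p := by positivity
  have hq' : (0 : ℝ) < q := by positivity
  set β : ℝ → ℝ := fun t => ((B⁻¹ + 4 * t * Complex.I)⁻¹).re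
  have hβ : ∀ t, 0 < β t := fun t => re_inv_pos (by simpa using re_inv_pos hB)
  have hN : ∀ t, eLpNorm (schrodingerPropagator t f) p volume =
      ENNReal.ofReal (K * β t ^ (1 / (q : ℝ))) * eLpNorm f 2 volume := fun t => by
    obtain ⟨A', u', h⟩ := schrodingerPropagator_gaussianFun A hB u t
    have h2 : eLpNorm f 2 volume = eLpNorm (schrodingerPropagator t f) 2 volume := by
      rw [← Lp.enorm_def, ← Lp.enorm_def, ← ofReal_norm, ← ofReal_norm, norm_schrodingerPropagator]
    rw [h2, eLpNorm_congr_ae h, eLpNorm_congr_ae h, eLpNorm_gaussianFun_eq_mul A' (hβ t) u' hp,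
      gaussian_const_eq hp' hpq (hβ t)]
  have hfin : eLpNorm f 2 volume ≠ ∞ := (Lp.memLp f).eLpNorm_ne_top
  rw [strichartzNorm, eLpNorm_nnreal_eq_lintegral hq]
  have hpt : ∀ t, ‖eLpNorm (schrodingerPropagator t f) p volume‖ₑ ^ (q : ℝ) =
      (ENNReal.ofReal K * eLpNorm f 2 volume) ^ (q : ℝ) * ENNReal.ofReal (β t) := fun t => by
    rw [enorm_eq_self, hN, ENNReal.ofReal_mul hK, mul_right_comm,
      ENNReal.mul_rpow_of_nonneg _ _ hq'.le,
      ENNReal.ofReal_rpow_of_nonneg (Real.rpow_nonneg (hβ t).le _) hq'.le,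
      ← Real.rpow_mul (hβ t).le, one_div_mul_cancel hq'.ne', Real.rpow_one]
  simp_rw [hpt]
  rw [lintegral_const_mul' _ _ (by finiteness), lintegral_re_inv_add (re_inv_pos hB),
    ENNReal.mul_rpow_of_nonneg _ _ (by positivity), ← ENNReal.rpow_mul,
    mul_one_div_cancel hq'.ne', ENNReal.rpow_one,
    ENNReal.ofReal_rpow_of_nonneg (by positivity) (by positivity), mul_right_comm,
    ← ENNReal.ofReal_mul hK, sharpConst_eq hp hpq]

end Gaussian
end

theorem mainTheorem5 (p q : ℝ≥0) (d : ℕ)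
    (hpqd : (p, q, d) ∈ ({(6, 6, 1), (4, 8, 1), (4, 4, 2)} : Set (ℝ≥0 × ℝ≥0 × ℕ))) :
    IsLeast {C : ℝ | StrichartzInequality p q d C} (sharpConst p d) ∧
    ∀ (A B : ℂ) (u : Fin d → ℂ), 0 < B.re →
      ∃ hf : MemLp (gaussianFun A B u) 2 volume,
        strichartzNorm p q (hf.toLp (gaussianFun A B u)) =
          ENNReal.ofReal (sharpConst p d) *
            eLpNorm (hf.toLp (gaussianFun A B u)) 2 volume := by
  obtain ⟨hp, hq, hpq⟩ : p ≠ 0 ∧ q ≠ 0 ∧ 1 / (q : ℝ) = d / 4 - d / (2 * p) := by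
    simp only [Set.mem_insert_iff, Set.mem_singleton_iff, Prod.mk.injEq] at hpqd
    rcases hpqd with ⟨rfl, rfl, rfl⟩ | ⟨rfl, rfl, rfl⟩ | ⟨rfl, rfl, rfl⟩ <;> norm_num
  refine ⟨⟨strichartzInequality_of_extensionInequality hp hq (extensionInequality_of_mem hpqd),
    fun C hC => ?_⟩, fun A B u hB =>
      ⟨memLp_gaussianFun A hB u, strichartzNorm_gaussianFun A hB u hp hq hpq⟩⟩
  -- Optimality is tested on `exp(-‖x‖²)`, whose nonzero finite norm can be cancelled.
  have hone : 0 < (1 : ℂ).re := by norm_num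
  have hg2 := eLpNorm_gaussianFun 1 hone (0 : Fin d → ℂ) (p := 2) (by norm_num)
  have h := hC ((memLp_gaussianFun 1 hone (0 : Fin d → ℂ)).toLp _)
  rw [strichartzNorm_gaussianFun 1 hone 0 hp hq hpq, eLpNorm_congr_ae (MemLp.coeFn_toLp _)] at h
  rw [ENNReal.coe_ofNat] at hg2
  have hpos : eLpNorm (gaussianFun 1 1 (0 : Fin d → ℂ)) 2 volume ≠ 0 := by
    rw [hg2, ne_eq, ENNReal.ofReal_eq_zero, not_le]
    have := Real.pi_pos
    simp only [norm_one, Complex.one_re]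
    positivity
  have hfin : eLpNorm (gaussianFun 1 1 (0 : Fin d → ℂ)) 2 volume ≠ ∞ := by
    rw [hg2]
    exact ENNReal.ofReal_ne_top
  have hle := (ENNReal.mul_le_mul_iff_left hpos hfin).1 h
  -- `ENNReal.ofReal` sends negative `C` to `0`, so positivity of the sharp constant is needed to
  -- compare the real numbers.
  have hC0 : 0 < sharpConst p d := by
    unfold sharpConst
    positivity
  by_contra hlt
  exact absurd hle (not_le.2 ((ENNReal.ofReal_lt_ofReal_iff hC0).2 (not_le.1 hlt)))
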